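/- All graphs are finite and simple. A graph is \emph{factorizable} if it has a perfect matching; the empty graph counts as factorizable. A factorizable graph $G$ is \emph{saturated} if for every pair of distinct non-adjacent vertices $x,y$ the graph $G+xy$ has more perfect matchings than $G$ (so the empty graph is saturated). An edge of a factorizable graph is \emph{allowed} if some perfect matching contains it, and the graph is \emph{elementary} if its allowed edges form exactly one connected component (in particular it is nonempty). For an elementary graph $G_0$, Kotzig's canonical partition $\mathcal P(G_0)$ is the set of equivalence classes of the relation: $u\sim v$ if and only if $u=v$ or $G_0-u-v$ is not factorizable. Given a saturated elementary graph $G_0$ (the \emph{foundation}) and a family $\{G_S\}_{S\in\mathcal P(G_0)}$ of saturated graphs (the \emph{towers}), some of which may be empty, the \emph{cathedral construction} takes the disjoint union of $G_0$ and all the $G_S$ and, for each $S\in\mathcal P(G_0)$, joins every vertex of $S$ to every vertex of $G_S$. For a graph $H$, let $D(H)$ be the set of vertices exposed by some maximum matching of $H$, let $A(H)$ be the set of vertices outside $D(H)$ with a neighbour in $D(H)$, and let $C(H)=V(H)\setminus(D(H)\cup A(H))$. **The Cathedral Theorem.** Let $G$ be a nonempty graph. Then $G$ is factorizable and saturated if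 and only if there are a subgraph $G_0$ of $G$ and a family $\mathcal T=\{G_S\}_{S\in\mathcal P(G_0)}$ of subgraphs of $G$ that are a foundation and a family of towers, such that $G$ is the graph obtained from $G_0$ and $\mathcal T$ by the cathedral construction. Moreover, whenever $G$ is obtained in this way from a foundation $G_0$ and towers $\{G_S\}_{S\in\mathcal P(G_0)}$: (i) an edge $e\in E(G)$ is allowed in $G$ if and only if it is an allowed edge of $G_0$ or of $G_S$ for some $S\in\mathcal P(G_0)$; (ii) if $G$ is also obtained from a foundation $G_0'$ and a family of towers $\mathcal T'$ by the cathedral construction, then $V(G_0)=V(G_0')$; (iii) $V(G_0)=V(G)\setminus\bigcup_{x\in V(G)} C(G-x)$. -/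

import Mathlib

/-- A graph is factorizable if it has a perfect matching (the empty graph is factorizable). -/
def Factorizable {V : Type*} (G : SimpleGraph V) : Prop :=
  ∃ M : G.Subgraph, M.IsPerfectMatching

/-- The number of perfect matchings of a (finite) graph. -/
noncomputable def numPerfectMatchings {V : Type*} (G : SimpleGraph V) : ℕ :=
  {M : G.Subgraph | M.IsPerfectMatching}.ncard

/-- A factorizable graph is saturated if adding any complement edge gives a graph with
more perfect matchings. -/
def Saturated {V : Type*} (G : SimpleGraph V) : Prop :=
  Factorizable G ∧ ∀ x y : V, x ≠ y → ¬ G.Adj x y →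
    numPerfectMatchings G < numPerfectMatchings (G ⊔ SimpleGraph.edge x y)

/-- An edge is allowed if some perfect matching contains it. -/
def IsAllowed {V : Type*} (G : SimpleGraph V) (e : Sym2 V) : Prop :=
  ∃ M : G.Subgraph, M.IsPerfectMatching ∧ e ∈ M.edgeSet

/-- The spanning subgraph of `G` whose edges are the allowed edges. When `G` is factorizable,
every vertex lies on an allowed edge, so the connected components of this graph are the
elementary components of `G`. -/
def allowedGraph {V : Type*} (G : SimpleGraph V) : SimpleGraph V :=
  SimpleGraph.fromEdgeSet {e | IsAllowed G e}

/-- A graph is elementary if it is factorizable and has exactly one elementary component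
(in particular it is nonempty). -/
def Elementary {V : Type*} (G : SimpleGraph V) : Prop :=
  Factorizable G ∧ (allowedGraph G).Connected

/-- The relation defining the (generalized) canonical partition: `u` and `v` lie in the same
factor-connected component and either `u = v` or `G - u - v` is not factorizable. -/
def CanonicalRel {V : Type*} (G : SimpleGraph V) (u v : V) : Prop :=
  (allowedGraph G).Reachable u v ∧ (u = v ∨ ¬ Factorizable (G.induce ({u, v}ᶜ : Set V)))

/-- The canonical partition of `G`: the set of classes of `CanonicalRel G`. -/
def canonicalPartition {V : Type*} (G : SimpleGraph V) : Set (Set V) :=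
  {S | ∃ u : V, S = {v | CanonicalRel G u v}}

/-- The cathedral construction: the disjoint union of the foundation `G₀` and of the towers
`T S`, one for each class `S` of the canonical partition of `G₀`, with every vertex of `S`
joined to every vertex of `T S`. -/
def cathedral {V₀ : Type*} (G₀ : SimpleGraph V₀) {W : canonicalPartition G₀ → Type*}
    (T : (S : canonicalPartition G₀) → SimpleGraph (W S)) :
    SimpleGraph (V₀ ⊕ (Σ S : canonicalPartition G₀, W S)) where
  Adj
    | Sum.inl u, Sum.inl v => G₀.Adj u v
    | Sum.inl u, Sum.inr p => u ∈ p.1.1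
    | Sum.inr p, Sum.inl u => u ∈ p.1.1
    | Sum.inr p, Sum.inr q => ∃ (S : canonicalPartition G₀) (a b : W S),
        p = ⟨S, a⟩ ∧ q = ⟨S, b⟩ ∧ (T S).Adj a b
  symm := ⟨by
    rintro (u | p) (v | q) h
    · exact G₀.adj_symm h
    · exact h
    · exact h
    · obtain ⟨S, a, b, hp, hq, hab⟩ := h
      exact ⟨S, b, a, hq, hp, hab.symm⟩⟩
  loopless := ⟨by
    rintro (u | p) h
    · exact G₀.irrefl h
    · obtain ⟨S, a, b, rfl, hq, hab⟩ := h
      cases hq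
      exact (T S).irrefl hab⟩

/-- The subgraphs `G₀` and `T S` of `G` form a foundation (a saturated elementary graph) and a
family of towers (saturated graphs, possibly empty) indexed by the canonical partition of `G₀`,
and `G` is the graph obtained from them by the cathedral construction: the map sending each
vertex of the construction to the corresponding vertex of `G` is an isomorphism. -/
structure IsCathedral {V : Type*} (G : SimpleGraph V) (G₀ : G.Subgraph)
    (T : canonicalPartition G₀.coe → G.Subgraph) : Prop where
  foundation_saturated : Saturated G₀.coe
  foundation_elementary : Elementary G₀.coe
  tower_saturated : ∀ S, Saturated (T S).coe
  construction : ∃ φ : cathedral G₀.coe (fun S => (T S).coe) ≃g G,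
    (∀ x : G₀.verts, φ (Sum.inl x) = (x : V)) ∧
    ∀ (S : canonicalPartition G₀.coe) (y : (T S).verts), φ (Sum.inr ⟨S, y⟩) = (y : V)

/-- A maximum matching: a matching with the largest possible number of edges. -/
def IsMaximumMatching {V : Type*} {G : SimpleGraph V} (M : G.Subgraph) : Prop :=
  M.IsMatching ∧ ∀ M' : G.Subgraph, M'.IsMatching → M'.edgeSet.ncard ≤ M.edgeSet.ncard

/-- `D(G)`: the vertices exposed by some maximum matching. -/
def gallaiD {V : Type*} (G : SimpleGraph V) : Set V :=
  {v | ∃ M : G.Subgraph, IsMaximumMatching M ∧ v ∉ M.verts}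

/-- `A(G)`: the vertices outside `D(G)` with a neighbour in `D(G)`. -/
def gallaiA {V : Type*} (G : SimpleGraph V) : Set V :=
  {v | v ∉ gallaiD G ∧ ∃ w ∈ gallaiD G, G.Adj w v}

/-- `C(G)`: the remaining vertices. -/
def gallaiC {V : Type*} (G : SimpleGraph V) : Set V :=
  Set.univ \ (gallaiD G ∪ gallaiA G)

/-- `C(G - x)`, as a set of vertices of `G`. -/
def gallaiCDelete {V : Type*} (G : SimpleGraph V) (x : V) : Set V :=
  Subtype.val '' gallaiC (G.induce ({x}ᶜ : Set V))

/-!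
For a set `U` of vertices, `FactorizableOff G U` says that `G - U` has a perfect matching. The
family of these sets has a simultaneous exchange property (`FactorizableOff.exchange`), a
statement about the ends of an alternating path. All arguments about alternating paths are
replaced by applications of it, mostly to sets of two or four vertices. Two vertices `x ≠ y` are
*linked* if `G - x - y` is factorizable. In a saturated graph non-adjacent vertices are linked,
and an edge is allowed if and only if its ends are linked.

A vertex `k ≠ y` is *above* `y` if it is not linked to `y` and has no neighbour linked to `y`; this
is membership in `C(G - y)` (`gallaiCDelete_eq`). By `Linked.above`, a vertex linked to neither
end of a linked pair has both ends above it. Hence the set of vertices above `y` is closed under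
allowed edges, and non-linkedness is transitive in elementary graphs, which is Kotzig's theorem
(`Elementary.not_linked_trans`).

In a saturated graph, being above is a strict partial order. Its minimal vertices, the *bottom*
vertices, span the foundation, and the tower over a class is the set of vertices above its
members. That this arrangement is the cathedral construction follows from the definitions and the
exchange property. Parts of the graph inherit saturation: a perfect matching leaving a tower is
excluded by exchange, and the matching edges between a class and its tower are even in number, so
that, classes being cliques, these edges can be replaced by edges within the class. The foundation
is elementary by `connected_allowedGraph_of_not_above`: no vertex lies above another in it, so
each class `B` is a maximal barrier, and perfect matchings join `B` bijectively to the odd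
components of `G - B`. If `B` met both a component `K` of the allowed graph and its complement,
then deleting `s` in `B ∩ K` and the partner of a vertex of `B \ K` would leave too few components
for `B \ K`.

Conversely, in a cathedral no edge between the foundation and a tower is allowed
(`IsDecomposition.map_mem`), again because such matching edges are even in number at each class
and all but two of their ends in the foundation can be matched inside cliques, whereas two
vertices of a class are not linked. This determines the allowed edges, and it identifies the
foundation with the set of vertices that lie above no vertex
(`IsDecomposition.mem_iff_not_above`), hence its uniqueness.
-/

open scoped symmDiff

/-! ### Matching maps and the exchange property -/

/-- An involution `m` of the vertex set which fixes the vertices of `U` and sends every other vertex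
to a neighbour of it, that is, a perfect matching of `G - U`. -/
structure IsMatchingMap {V : Type*} (G : SimpleGraph V) (U : Set V) (m : V → V) : Prop where
  invol : ∀ v, m (m v) = v
  fixed : ∀ v ∈ U, m v = v
  adj : ∀ v ∉ U, G.Adj v (m v)

/-- `G - U` is factorizable. -/
def FactorizableOff {V : Type*} (G : SimpleGraph V) (U : Set V) : Prop :=
  ∃ m, IsMatchingMap G U m

namespace IsMatchingMap

variable {V : Type*} {G : SimpleGraph V} {U : Set V} {m : V → V}

lemma notMem (h : IsMatchingMap G U m) {v : V} (hv : v ∉ U) : m v ∉ U := fun hm => by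
  have h1 := h.fixed _ hm
  rw [h.invol] at h1
  exact (h.adj v hv).ne h1

lemma factorizableOff (h : IsMatchingMap G U m) : FactorizableOff G U := ⟨m, h⟩

lemma inj (h : IsMatchingMap G U m) {v w : V} (e : m v = m w) : v = w := by
  rw [← h.invol v, e, h.invol]

/-- Deleting a set that is closed under the matching. -/
lemma union (h : IsMatchingMap G U m) {A : Set V} (hA : ∀ v ∈ A, m v ∈ A) :
    FactorizableOff G (U ∪ A) := by
  classical
  have hA' : ∀ v, v ∉ A → m v ∉ A := fun v hv hm => hv (by simpa [h.invol] using hA _ hm)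
  refine ⟨fun v => if v ∈ A then v else m v, fun v => ?_, fun v hv => ?_, fun v hv => ?_⟩
  · by_cases hv : v ∈ A <;> simp [hv, hA', h.invol]
  · by_cases hvA : v ∈ A
    · simp [hvA]
    · simpa [hvA] using h.fixed v (hv.resolve_right hvA)
  · simp only [Set.mem_union, not_or] at hv
    simpa [hv.2] using h.adj v hv.1

/-- Deleting the two ends of a matching edge. -/
lemma union_pair (h : IsMatchingMap G U m) (v : V) : FactorizableOff G (U ∪ {v, m v}) :=
  h.union (by rintro w (rfl | rfl) <;> simp [h.invol])

/-- Modulo two, the size of a set is the number of matching edges leaving it. -/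
lemma even_ncard_iff [Finite V] (h : IsMatchingMap G U m) (A : Set V) (hAU : Disjoint A U) :
    Even A.ncard ↔ Even {v ∈ A | m v ∉ A}.ncard := by
  classical
  have hc : {v ∈ A | m v ∈ A}.ncard + {v ∈ A | m v ∉ A}.ncard = A.ncard := by
    rw [← Set.ncard_union_eq]
    · congr 1
      ext v
      simp only [Set.mem_union, Set.mem_ofPred_eq]
      tauto
    · rw [Set.disjoint_left]
      rintro v ⟨-, h1⟩ ⟨-, h2⟩
      exact h2 h1
  have he : Even {v ∈ A | m v ∈ A}.ncard := by
    cases nonempty_fintype V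
    rw [Set.ncard_eq_toFinset_card']
    have hs : ∑ _v ∈ {v ∈ A | m v ∈ A}.toFinset, (1 : ZMod 2) = 0 := by
      refine Finset.sum_involution (fun v _ => m v) (fun v _ => by decide) (fun v hv _ => ?_)
        (fun v hv => ?_) (fun v _ => h.invol v)
      · rw [Set.mem_toFinset] at hv
        exact (h.adj v (Set.disjoint_left.1 hAU hv.1)).ne'
      · rw [Set.mem_toFinset] at hv ⊢
        exact ⟨hv.2, by rw [h.invol]; exact hv.1⟩
    rw [Finset.sum_const, nsmul_one] at hs
    exact (ZMod.natCast_eq_zero_iff_even).1 hs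
  rw [← hc, Nat.even_add]
  tauto

/-- A set closed under the matching has an even number of elements. -/
lemma even_ncard [Finite V] (h : IsMatchingMap G U m) {A : Set V} (hAU : Disjoint A U)
    (hA : ∀ v ∈ A, m v ∈ A) : Even A.ncard := by
  rw [h.even_ncard_iff A hAU]
  have : {v ∈ A | m v ∉ A} = ∅ := by
    ext v
    simpa using hA v
  simp [this]

end IsMatchingMap

namespace FactorizableOff

variable {V : Type*} {G : SimpleGraph V} {U U' : Set V}

/-- Adding an edge between two deleted vertices. -/
lemma diff_pair (h : FactorizableOff G U) {x y : V} (hx : x ∈ U) (hy : y ∈ U)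
    (hxy : G.Adj x y) : FactorizableOff G (U \ {x, y}) := by
  classical
  obtain ⟨m, hm⟩ := h
  have hmx := hm.fixed x hx
  have hmy := hm.fixed y hy
  have key : ∀ v, v ≠ x → v ≠ y → m v ≠ x ∧ m v ≠ y := fun v h1 h2 =>
    ⟨fun e => h1 (hm.inj (e.trans hmx.symm)), fun e => h2 (hm.inj (e.trans hmy.symm))⟩
  refine ⟨fun v => if v = x then y else if v = y then x else m v, fun v => ?_, fun v hv => ?_,
    fun v hv => ?_⟩
  · by_cases h1 : v = x
    · simp [h1, hxy.ne']
    · by_cases h2 : v = y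
      · simp [h2, hxy.ne']
      · simp [h1, h2, key v h1 h2, hm.invol]
  · simp only [Set.mem_sdiff, Set.mem_insert_iff, Set.mem_singleton_iff, not_or] at hv
    simpa [hv.2] using hm.fixed v hv.1
  · by_cases h1 : v = x
    · simp [h1, hxy]
    · by_cases h2 : v = y
      · simp [h2, hxy.symm, hxy.ne']
      · simpa [h1, h2] using hm.adj v (fun hv' => hv ⟨hv', by simp [h1, h2]⟩)

lemma congr (h : FactorizableOff G U) (e : U = U') : FactorizableOff G U' := e ▸ h

/-- The exchange property for `a ∈ U \ U'`, by induction on the number of vertices outside `U'`: the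
alternating path from `a` is shortened by deleting its first two vertices. -/
lemma exchange_aux [Finite V] (n : ℕ) : ∀ {U U' : Set V} {a : V}, U'ᶜ.ncard ≤ n →
    FactorizableOff G U → FactorizableOff G U' → a ∈ U → a ∉ U' →
    ∃ b ∈ U ∆ U', b ≠ a ∧ FactorizableOff G (U ∆ {a, b}) ∧ FactorizableOff G (U' ∆ {a, b}) := by
  induction n with
  | zero =>
    intro U U' a hn _ _ _ ha'
    rw [Nat.le_zero, Set.ncard_eq_zero] at hn
    exact absurd (show a ∈ U'ᶜ from ha') (by simp [hn])
  | succ n ih =>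
    rintro U U' a hn ⟨m, hm⟩ ⟨m', hm'⟩ ha ha'
    -- Follow the alternating path `a, m' a, m (m' a), …`.
    have hne : a ≠ m' a := (hm'.adj a ha').ne
    have h1' : m' a ∉ U' := hm'.notMem ha'
    by_cases h1 : m' a ∈ U
    · refine ⟨m' a, Or.inl ⟨h1, h1'⟩, hne.symm, ?_, ?_⟩
      · refine (hm.factorizableOff.diff_pair ha h1 (hm'.adj a ha')).congr ?_
        ext v; simp only [Set.mem_symmDiff, Set.mem_sdiff, Set.mem_insert_iff,
          Set.mem_singleton_iff]; grind
      · refine (hm'.union_pair a).congr ?_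
        ext v; simp only [Set.mem_symmDiff, Set.mem_union, Set.mem_insert_iff,
          Set.mem_singleton_iff]; grind
    have hadj2 := hm.adj _ h1
    have h2 : m (m' a) ∉ U := hm.notMem h1
    have hE : FactorizableOff G (U ∪ {m' a, m (m' a)}) := hm.union_pair _
    have hE' : FactorizableOff G (U' ∪ {a, m' a}) := hm'.union_pair a
    have h2a : m (m' a) ≠ a := fun e => h2 (by rw [e]; exact ha)
    generalize hb : m' a = b at *
    generalize hc : m b = c at *
    have hcb : c ≠ b := hadj2.ne'
    by_cases h2' : c ∈ U'
    · refine ⟨c, Or.inr ⟨h2', h2⟩, h2a, ?_, ?_⟩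
      · refine (hE.diff_pair (x := a) (y := b) (by simp [ha]) (by simp)
          (hb ▸ hm'.adj a ha')).congr ?_
        ext v; simp only [Set.mem_symmDiff, Set.mem_sdiff, Set.mem_union, Set.mem_insert_iff,
          Set.mem_singleton_iff]; grind
      · refine (hE'.diff_pair (x := b) (y := c) (by simp) (by simp [h2']) hadj2).congr ?_
        ext v; simp only [Set.mem_symmDiff, Set.mem_sdiff, Set.mem_union, Set.mem_insert_iff,
          Set.mem_singleton_iff]; grind
    · obtain ⟨d, hd, hdc, hd1, hd2⟩ := ih (U := U ∪ {b, c}) (U' := U' ∪ {a, b}) (a := c)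
        (by
          have : (U' ∪ {a, b})ᶜ.ncard < U'ᶜ.ncard := by
            refine Set.ncard_lt_ncard ?_
            rw [Set.ssubset_iff_of_subset (by intro v; simp)]
            exact ⟨a, ha', by simp⟩
          omega) hE hE' (by simp) (by simp [h2', h2a, hcb])
      have hd' : d ≠ a ∧ d ≠ b := by
        simp only [Set.mem_symmDiff, Set.mem_union, Set.mem_insert_iff,
          Set.mem_singleton_iff] at hd
        grind
      refine ⟨d, ?_, hd'.1, ?_, ?_⟩
      · simp only [Set.mem_symmDiff, Set.mem_union, Set.mem_insert_iff,
          Set.mem_singleton_iff] at hd ⊢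
        grind
      · refine (hd1.diff_pair (x := a) (y := b) ?_ ?_ (hb ▸ hm'.adj a ha')).congr ?_
        · simp only [Set.mem_symmDiff, Set.mem_union, Set.mem_insert_iff,
            Set.mem_singleton_iff]; grind
        · simp only [Set.mem_symmDiff, Set.mem_union, Set.mem_insert_iff,
            Set.mem_singleton_iff]; grind
        · ext v; simp only [Set.mem_symmDiff, Set.mem_sdiff, Set.mem_union, Set.mem_insert_iff,
            Set.mem_singleton_iff]; grind
      · refine (hd2.diff_pair (x := b) (y := c) ?_ ?_ hadj2).congr ?_
        · simp only [Set.mem_symmDiff, Set.mem_union, Set.mem_insert_iff,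
            Set.mem_singleton_iff]; grind
        · simp only [Set.mem_symmDiff, Set.mem_union, Set.mem_insert_iff,
            Set.mem_singleton_iff]; grind
        · ext v; simp only [Set.mem_symmDiff, Set.mem_sdiff, Set.mem_union, Set.mem_insert_iff,
            Set.mem_singleton_iff]; grind

/-- The simultaneous exchange property of the sets `U` for which `G - U` is factorizable. In terms
of perfect matchings `M` of `G - U` and `M'` of `G - U'`, the vertices `a` and `b` are the ends of a
path of `M ∆ M'`. -/
theorem exchange [Finite V] (h : FactorizableOff G U) (h' : FactorizableOff G U') {a : V}
    (ha : a ∈ U ∆ U') :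
    ∃ b ∈ U ∆ U', b ≠ a ∧ FactorizableOff G (U ∆ {a, b}) ∧ FactorizableOff G (U' ∆ {a, b}) := by
  rcases ha with ⟨h1, h2⟩ | ⟨h1, h2⟩
  · exact exchange_aux _ le_rfl h h' h1 h2
  · obtain ⟨b, hb, hba, h3, h4⟩ := exchange_aux _ le_rfl h' h h1 h2
    exact ⟨b, symmDiff_comm U U' ▸ hb, hba, h4, h3⟩

/-- The exchange property when the second set is empty: `U` splits off a pair containing `a`. -/
lemma exists_pair [Finite V] (h₀ : FactorizableOff G ∅) (h : FactorizableOff G U) {a : V}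
    (ha : a ∈ U) :
    ∃ b ∈ U, b ≠ a ∧ FactorizableOff G {a, b} ∧ FactorizableOff G (U \ {a, b}) := by
  obtain ⟨b, hb, hba, h1, h2⟩ := h.exchange h₀ (a := a) (Or.inl ⟨ha, by simp⟩)
  have hb : b ∈ U := by simpa [Set.mem_symmDiff] using hb
  refine ⟨b, hb, hba, h2.congr (by simp [← Set.bot_eq_empty]), h1.congr ?_⟩
  ext v
  simp only [Set.mem_symmDiff, Set.mem_sdiff, Set.mem_insert_iff, Set.mem_singleton_iff]
  grind

/-- If `W` splits into cliques of even size (the fibres of `ℓ`), the vertices of `W` can be matched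
among themselves. -/
lemma of_union_cliques [Finite V] {ι : Type*} (ℓ : V → ι) (n : ℕ) : ∀ {U W : Set V},
    W.ncard ≤ n → Disjoint U W → (∀ x ∈ W, ∀ y ∈ W, x ≠ y → ℓ x = ℓ y → G.Adj x y) →
    (∀ i, Even {x ∈ W | ℓ x = i}.ncard) → FactorizableOff G (U ∪ W) → FactorizableOff G U := by
  induction n with
  | zero =>
    intro U W hn _ _ _ h
    rw [Nat.le_zero, Set.ncard_eq_zero] at hn
    simpa [hn] using h
  | succ n ih =>
    intro U W hn hd hcl hev h
    rcases W.eq_empty_or_nonempty with rfl | ⟨x, hx⟩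
    · simpa using h
    obtain ⟨y, ⟨hy, hxy⟩, hne⟩ : ∃ y ∈ {y ∈ W | ℓ y = ℓ x}, y ≠ x := by
      by_contra! hc
      have : {y ∈ W | ℓ y = ℓ x} = {x} := by
        ext y
        exact ⟨fun hy => hc y hy, by rintro rfl; exact ⟨hx, rfl⟩⟩
      have h2 := hev (ℓ x)
      rw [this] at h2
      simp at h2
    have hUx : x ∉ U := fun h' => Set.disjoint_left.1 hd h' hx
    have hUy : y ∉ U := fun h' => Set.disjoint_left.1 hd h' hy
    refine ih (W := W \ {x, y}) ?_ (hd.mono_right Set.sdiff_subset)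
      (fun a ha b hb => hcl a ha.1 b hb.1) (fun i => ?_) ?_
    · have : (W \ {x, y}).ncard < W.ncard := Set.ncard_lt_ncard
        ((Set.ssubset_iff_of_subset Set.sdiff_subset).2 ⟨x, hx, by simp⟩)
      omega
    · by_cases hi : ℓ x = i
      · have hs : {z ∈ W \ {x, y} | ℓ z = i} = {z ∈ W | ℓ z = i} \ {x, y} := by
          ext z; simp only [Set.mem_ofPred_eq, Set.mem_sdiff]; tauto
        have hc := Set.ncard_sdiff_add_ncard_of_subset (s := {x, y}) (t := {z ∈ W | ℓ z = i})
          (by rintro z (rfl | rfl) <;> simp [hx, hy, hi, hxy])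
        rw [Set.ncard_pair hne.symm] at hc
        have := hev i
        rw [← hc, Nat.even_add] at this
        rw [hs]
        exact this.2 even_two
      · have hs : {z ∈ W \ {x, y} | ℓ z = i} = {z ∈ W | ℓ z = i} := by
          ext z
          simp only [Set.mem_ofPred_eq, Set.mem_sdiff, Set.mem_insert_iff, Set.mem_singleton_iff]
          grind
        rw [hs]
        exact hev i
    · refine (h.diff_pair (x := x) (y := y) (by simp [hx]) (by simp [hy])
        (hcl x hx y hy hne.symm hxy.symm)).congr ?_
      ext z
      simp only [Set.mem_union, Set.mem_sdiff, Set.mem_insert_iff, Set.mem_singleton_iff]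
      grind

/-- Perfect matchings of the parts of a partition (the fibres of `ℓ`) combine. -/
lemma exists_glue {ι : Type*} (ℓ : V → ι)
    (h : ∀ i, FactorizableOff G ({v | ℓ v ≠ i} ∪ U)) :
    ∃ m, IsMatchingMap G U m ∧ ∀ v, ℓ (m v) = ℓ v := by
  choose m hm using h
  have hℓ : ∀ v, ℓ (m (ℓ v) v) = ℓ v := fun v => by
    by_cases hv : v ∈ U
    · rw [(hm _).fixed v (Or.inr hv)]
    · have := (hm (ℓ v)).notMem (v := v) (by simp [hv])
      simp only [Set.mem_union, Set.mem_ofPred_eq, not_or, not_not] at this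
      exact this.1
  refine ⟨fun v => m (ℓ v) v, ⟨fun v => ?_, fun v hv => (hm _).fixed v (Or.inr hv), fun v hv =>
    (hm _).adj v (by simp [hv])⟩, hℓ⟩
  simp only [hℓ, (hm _).invol]

end FactorizableOff

/-- The part of a perfect matching inside a set `A`: it covers the vertices of `A` whose partner is
in `A`. -/
lemma IsMatchingMap.restrict {V : Type*} {G : SimpleGraph V} {U : Set V} {m : V → V}
    (h : IsMatchingMap G U m) (A : Set V) :
    FactorizableOff G (Aᶜ ∪ U ∪ {v ∈ A | m v ∉ A}) := by
  refine (h.union (A := {v | v ∉ A ∨ m v ∉ A}) (fun v hv => ?_)).congr ?_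
  · simpa [h.invol, or_comm] using hv
  · ext v
    simp only [Set.mem_union, Set.mem_ofPred_eq, Set.mem_compl_iff]
    tauto

/-- Let the vertices outside `A` be arranged in even towers, such that the matching edges leaving
`A` lead from the class `{x ∈ A | ℓ x = i}` to the tower `tw i` and these classes are cliques. The
number of matching edges between a class and its tower is even, so their ends in the class can be
matched among themselves. -/
lemma IsMatchingMap.factorizableOff_of_towers {V : Type*} [Finite V] {G : SimpleGraph V} {U : Set V}
    {m : V → V} (h : IsMatchingMap G U m) {ι : Type*} (ℓ : V → ι) {A : Set V} {tw : ι → Set V}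
    (hcl : ∀ x ∈ A, ∀ y ∈ A, x ≠ y → ℓ x = ℓ y → G.Adj x y)
    (hev : ∀ i, Even (tw i).ncard) (hevU : ∀ i, Even (tw i ∩ U).ncard)
    (hA : ∀ i, ∀ x ∈ tw i, x ∉ A) (hup : ∀ x ∈ A, m x ∉ A → m x ∈ tw (ℓ x))
    (hdown : ∀ i, ∀ x ∈ tw i, x ∉ U → m x ∉ tw i → m x ∈ A ∧ ℓ (m x) = i) :
    FactorizableOff G (Aᶜ ∪ U) := by
  refine FactorizableOff.of_union_cliques ℓ _ le_rfl ?_ (fun x hx y hy => hcl x hx.1 y hy.1) ?_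
    (h.restrict A)
  · rw [Set.disjoint_left]
    rintro x (hx | hx) ⟨hx', hmx⟩
    · exact hx hx'
    · exact hmx (by rwa [h.fixed x hx])
  · intro i
    have himg : {x ∈ {v ∈ A | m v ∉ A} | ℓ x = i} = m '' {c ∈ tw i \ U | m c ∉ tw i \ U} := by
      ext s
      simp only [Set.mem_ofPred_eq, Set.mem_image]
      constructor
      · rintro ⟨⟨hs, hms⟩, rfl⟩
        have hsU : s ∉ U := fun hU => hms (by rwa [h.fixed s hU])
        refine ⟨m s, ⟨⟨hup s hs hms, h.notMem hsU⟩, ?_⟩, h.invol s⟩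
        rw [h.invol]
        exact fun h' => hA _ s h'.1 hs
      · rintro ⟨c, ⟨⟨hc, hcU⟩, hmc⟩, rfl⟩
        obtain ⟨h1, h2⟩ := hdown i c hc hcU (fun h' => hmc ⟨h', h.notMem hcU⟩)
        exact ⟨⟨h1, by rw [h.invol]; exact hA i c hc⟩, h2⟩
    rw [himg, Set.ncard_image_of_injective _ (fun a b e => h.inj e),
      ← h.even_ncard_iff _ Set.disjoint_sdiff_left]
    have := hev i
    rw [← Set.ncard_inter_add_ncard_sdiff_eq_ncard (tw i) U, Nat.even_add] at this
    exact this.1 (hevU i)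

/-- Inside a set closed under a perfect matching, this matching can be replaced by another one. -/
lemma IsMatchingMap.factorizableOff_of_closed {V : Type*} {G : SimpleGraph V} {n : V → V}
    (hn : IsMatchingMap G ∅ n) {A U : Set V} (hA : ∀ v ∈ A, n v ∈ A) (hU : U ⊆ A)
    (h : FactorizableOff G (Aᶜ ∪ U)) : FactorizableOff G U := by
  obtain ⟨m, hm, -⟩ := FactorizableOff.exists_glue (G := G) (U := U) (fun v => v ∈ A) (fun i => by
    by_cases hi : i
    · refine h.congr ?_
      ext v; simp [hi]
    · refine (hn.union hA).congr ?_
      ext v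
      simpa [hi] using fun h => hU h)
  exact hm.factorizableOff

/-! ### Translation between matching subgraphs and matching maps -/

section Translation

variable {V : Type*} {G : SimpleGraph V}

lemma SimpleGraph.Subgraph.IsPerfectMatching.exists_isMatchingMap {M : G.Subgraph}
    (hM : M.IsPerfectMatching) : ∃ m, IsMatchingMap G ∅ m ∧ ∀ v w, M.Adj v w ↔ m v = w := by
  rw [SimpleGraph.Subgraph.isPerfectMatching_iff] at hM
  choose m hm hu using hM
  have key : ∀ v w, M.Adj v w ↔ m v = w := fun v w => ⟨fun h => (hu v w h).symm, fun h => h ▸ hm v⟩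
  exact ⟨m, ⟨fun v => (key _ _).1 (hm v).symm, by simp, fun v _ => (hm v).adj_sub⟩, key⟩

lemma IsMatchingMap.exists_isPerfectMatching {m : V → V} (h : IsMatchingMap G ∅ m) :
    ∃ M : G.Subgraph, M.IsPerfectMatching ∧ ∀ v w, M.Adj v w ↔ m v = w := by
  refine ⟨{ verts := Set.univ, Adj := fun v w => m v = w, adj_sub := ?_, edge_vert := by simp,
            symm := ⟨?_⟩ }, ?_, fun v w => Iff.rfl⟩
  · rintro v _ rfl
    exact h.adj v (by simp)
  · rintro v _ rfl
    exact h.invol v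
  · rw [SimpleGraph.Subgraph.isPerfectMatching_iff]
    exact fun v => ⟨m v, rfl, fun w hw => Eq.symm hw⟩

lemma factorizable_iff : Factorizable G ↔ FactorizableOff G ∅ :=
  ⟨fun ⟨_, hM⟩ => let ⟨_, hm, _⟩ := hM.exists_isMatchingMap; hm.factorizableOff,
    fun ⟨_, hm⟩ => let ⟨M, hM, _⟩ := hm.exists_isPerfectMatching; ⟨M, hM⟩⟩

lemma factorizableOff_induce_iff {A : Set V} {U : Set A} :
    FactorizableOff (G.induce A) U ↔ FactorizableOff G (Aᶜ ∪ Subtype.val '' U) := by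
  classical
  constructor
  · rintro ⟨m, hm⟩
    refine ⟨fun v => if hv : v ∈ A then m ⟨v, hv⟩ else v, fun v => ?_, fun v hv => ?_,
      fun v hv => ?_⟩
    · by_cases hv : v ∈ A <;> simp [hv, hm.invol]
    · by_cases hvA : v ∈ A
      · have : (⟨v, hvA⟩ : A) ∈ U := by simpa [hvA] using hv
        simp [hvA, hm.fixed _ this]
      · simp [hvA]
    · simp only [Set.mem_union, Set.mem_compl_iff, not_or, not_not] at hv
      have := hm.adj ⟨v, hv.1⟩ (fun h => hv.2 ⟨_, h, rfl⟩)
      simpa [hv.1] using this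
  · rintro ⟨m, hm⟩
    have hA : ∀ v, v ∈ A → m v ∈ A := fun v hv => by
      by_contra hmv
      have h1 := hm.fixed (m v) (Or.inl hmv)
      rw [hm.invol] at h1
      exact hmv (h1 ▸ hv)
    refine ⟨fun v => ⟨m v, hA v v.2⟩, fun v => ?_, fun v hv => ?_, fun v hv => ?_⟩
    · simp [hm.invol]
    · simp [hm.fixed v (Or.inr ⟨v, hv, rfl⟩)]
    · exact hm.adj v (by simp [hv])

lemma factorizable_induce_iff {A : Set V} :
    Factorizable (G.induce A) ↔ FactorizableOff G Aᶜ := by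
  rw [factorizable_iff, factorizableOff_induce_iff, Set.image_empty, Set.union_empty]

lemma factorizable_induce_compl_iff {U : Set V} :
    Factorizable (G.induce Uᶜ) ↔ FactorizableOff G U := by
  rw [factorizable_induce_iff, compl_compl]

/-- Two distinct vertices `x` and `y` are linked if `G - x - y` is factorizable. -/
def Linked {V : Type*} (G : SimpleGraph V) (x y : V) : Prop :=
  x ≠ y ∧ FactorizableOff G {x, y}

lemma Linked.symm {x y : V} (h : Linked G x y) : Linked G y x :=
  ⟨h.1.symm, h.2.congr (Set.pair_comm x y)⟩

lemma IsMatchingMap.linked {m : V → V} (h : IsMatchingMap G ∅ m) (v : V) : Linked G v (m v) :=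
  ⟨(h.adj v (by simp)).ne, (h.union_pair v).congr (by simp)⟩

/-- A linked edge lies in a perfect matching. -/
lemma Linked.exists_isMatchingMap {x y : V} (h : Linked G x y) (hxy : G.Adj x y) :
    ∃ m, IsMatchingMap G ∅ m ∧ m x = y := by
  classical
  obtain ⟨m, hm⟩ := h.2
  have hmx := hm.fixed x (by simp)
  have hmy := hm.fixed y (by simp)
  have key : ∀ v, v ≠ x → v ≠ y → m v ≠ x ∧ m v ≠ y := fun v h1 h2 =>
    ⟨fun e => h1 (hm.inj (e.trans hmx.symm)), fun e => h2 (hm.inj (e.trans hmy.symm))⟩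
  refine ⟨fun v => if v = x then y else if v = y then x else m v, ⟨fun v => ?_, by simp,
    fun v hv => ?_⟩, by simp⟩
  · by_cases h1 : v = x
    · simp [h1, hxy.ne']
    · by_cases h2 : v = y
      · simp [h2, hxy.ne']
      · simp [h1, h2, key v h1 h2, hm.invol]
  · by_cases h1 : v = x
    · simp [h1, hxy]
    · by_cases h2 : v = y
      · simp [h2, hxy.symm, hxy.ne']
      · simpa [h1, h2] using hm.adj v (by simp [h1, h2])

lemma isAllowed_iff {x y : V} : IsAllowed G s(x, y) ↔ G.Adj x y ∧ Linked G x y := by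
  constructor
  · rintro ⟨M, hM, he⟩
    obtain ⟨m, hm, hMm⟩ := hM.exists_isMatchingMap
    rw [SimpleGraph.Subgraph.mem_edgeSet, hMm] at he
    subst he
    exact ⟨hm.adj x (by simp), hm.linked x⟩
  · rintro ⟨h1, h2⟩
    obtain ⟨m, hm, hxy⟩ := h2.exists_isMatchingMap h1
    obtain ⟨M, hM, hMm⟩ := hm.exists_isPerfectMatching
    exact ⟨M, hM, by rw [SimpleGraph.Subgraph.mem_edgeSet, hMm, hxy]⟩

lemma allowedGraph_adj {x y : V} : (allowedGraph G).Adj x y ↔ G.Adj x y ∧ Linked G x y := by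
  rw [allowedGraph, SimpleGraph.fromEdgeSet_adj]
  exact ⟨fun h => isAllowed_iff.1 h.1, fun h => ⟨isAllowed_iff.2 h, h.1.ne⟩⟩

/-- A factorizable graph is saturated if and only if non-adjacent vertices are linked. -/
lemma saturated_iff [Finite V] :
    Saturated G ↔ FactorizableOff G ∅ ∧ ∀ x y, x ≠ y → ¬ G.Adj x y → Linked G x y := by
  rw [Saturated, factorizable_iff]
  refine and_congr_right fun _ => forall₂_congr fun x y => forall₂_congr fun hxy hadj => ?_
  have hle : G ≤ G ⊔ SimpleGraph.edge x y := le_sup_left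
  let f : G.Subgraph → (G ⊔ SimpleGraph.edge x y).Subgraph :=
    fun M => M.map (SimpleGraph.Hom.ofLE hle)
  have hfadj : ∀ M v w, (f M).Adj v w ↔ M.Adj v w := fun M v w => by
    simp [f, Relation.map_apply]
  have hf : Function.Injective f := fun M N h => by
    ext v w
    · simpa [f] using congrArg (v ∈ ·.verts) h
    · rw [← hfadj, h, hfadj]
  have hfm : f '' {M | M.IsPerfectMatching} ⊆ {M | M.IsPerfectMatching} := by
    rintro _ ⟨M, hM, rfl⟩
    simp only [Set.mem_ofPred_eq, SimpleGraph.Subgraph.isPerfectMatching_iff, hfadj] at hM ⊢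
    exact hM
  have hcard : numPerfectMatchings G = (f '' {M | M.IsPerfectMatching}).ncard := by
    rw [Set.ncard_image_of_injective _ hf]; rfl
  rw [hcard]
  constructor
  · intro h
    obtain ⟨M, hM, hMf⟩ : ∃ M : (G ⊔ SimpleGraph.edge x y).Subgraph,
        M.IsPerfectMatching ∧ M ∉ f '' {M | M.IsPerfectMatching} := by
      by_contra! hc
      exact absurd (Set.ncard_le_ncard (fun M hM => hc M hM)) (not_le.2 h)
    obtain ⟨m, hm, hMm⟩ := hM.exists_isMatchingMap
    have hG : ∀ v, m v ≠ v → (G.Adj v (m v) ∨ (v = x ∧ m v = y ∨ v = y ∧ m v = x)) := fun v _ => by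
      have := hm.adj v (by simp)
      rw [SimpleGraph.sup_adj, SimpleGraph.edge_adj] at this
      tauto
    by_cases hmx : m x = y
    · refine ⟨hxy, ?_⟩
      have hmy : m y = x := by rw [← hmx, hm.invol]
      have h2 := hm.union (A := {x, y}) (by rintro v (rfl | rfl) <;> simp [hmx, hmy])
      obtain ⟨m', hm'⟩ := h2
      refine ⟨m', hm'.invol, fun v hv => hm'.fixed v (Or.inr hv), fun v hv => ?_⟩
      have := hm'.adj v (by simpa using hv)
      rw [SimpleGraph.sup_adj, SimpleGraph.edge_adj] at this
      simp only [Set.mem_insert_iff, Set.mem_singleton_iff, not_or] at hv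
      tauto
    · exfalso
      have hmG : IsMatchingMap G ∅ m := ⟨hm.invol, hm.fixed, fun v hv => by
        have h1 := hG v (hm.adj v hv).ne'
        rcases h1 with h1 | ⟨rfl, h1⟩ | ⟨rfl, h1⟩
        · exact h1
        · exact absurd h1 hmx
        · exact absurd (by rw [← h1, hm.invol]) hmx⟩
      obtain ⟨M', hM', hMm'⟩ := hmG.exists_isPerfectMatching
      refine hMf ⟨M', hM', ?_⟩
      ext v w
      · exact iff_of_true ((hfm ⟨M', hM', rfl⟩ : (f M').IsPerfectMatching).2 v) (hM.2 v)
      · rw [hfadj, hMm, hMm']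
  · intro h
    refine Set.ncard_lt_ncard ((Set.ssubset_iff_of_subset hfm).2 ?_)
    have h' : Linked (G ⊔ SimpleGraph.edge x y) x y := by
      obtain ⟨m, hm⟩ := h.2
      exact ⟨hxy, m, hm.invol, hm.fixed, fun v hv => hle (hm.adj v hv)⟩
    obtain ⟨m, hm, hmx⟩ := h'.exists_isMatchingMap (by simp [SimpleGraph.edge_adj, hxy])
    obtain ⟨M, hM, hMm⟩ := hm.exists_isPerfectMatching
    refine ⟨M, hM, ?_⟩
    rintro ⟨M', -, rfl⟩
    have := (hMm x y).2 hmx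
    rw [hfadj] at this
    exact hadj this.adj_sub

lemma linked_induce_iff {A : Set V} {x y : A} :
    Linked (G.induce A) x y ↔ (x : V) ≠ y ∧ FactorizableOff G (Aᶜ ∪ {(x : V), (y : V)}) := by
  rw [Linked, factorizableOff_induce_iff, Set.image_pair, Ne, Subtype.ext_iff]

lemma canonicalRel_iff (hG : (allowedGraph G).Connected) {u v : V} :
    CanonicalRel G u v ↔ ¬ Linked G u v := by
  rw [CanonicalRel, factorizable_induce_compl_iff, Linked]
  have := hG.preconnected u v
  tauto

end Translation

/-! ### Linked pairs and the order on vertices -/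

section Above

variable {V : Type*} [Finite V] {G : SimpleGraph V}

lemma Linked.exchange {a b c d : V} (h1 : Linked G a b) (h2 : Linked G c d)
    (hac : a ≠ c) (had : a ≠ d) (hbc : b ≠ c) (hbd : b ≠ d) :
    (Linked G c b ∧ Linked G a d) ∨ (Linked G c a ∧ Linked G b d) ∨
      FactorizableOff G {a, b, c, d} := by
  obtain ⟨e, he, hec, h3, h4⟩ := h1.2.exchange h2.2 (a := c)
    (Or.inr ⟨by simp, by simp [hac.symm, hbc.symm]⟩)
  have hab := h1.1
  have hcd := h2.1
  have he' : e = a ∨ e = b ∨ e = d := by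
    simp only [Set.mem_symmDiff, Set.mem_insert_iff, Set.mem_singleton_iff] at he
    tauto
  rcases he' with rfl | rfl | rfl
  · refine Or.inl ⟨⟨hbc.symm, h3.congr ?_⟩, ⟨had, h4.congr ?_⟩⟩ <;>
    · ext v; simp only [Set.mem_symmDiff, Set.mem_insert_iff, Set.mem_singleton_iff]; grind
  · refine Or.inr (Or.inl ⟨⟨hac.symm, h3.congr ?_⟩, ⟨hbd, h4.congr ?_⟩⟩) <;>
    · ext v; simp only [Set.mem_symmDiff, Set.mem_insert_iff, Set.mem_singleton_iff]; grind
  · refine Or.inr (Or.inr (h3.congr ?_))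
    ext v; simp only [Set.mem_symmDiff, Set.mem_insert_iff, Set.mem_singleton_iff]; grind

/-- `k` lies above `y` if `k` is neither linked to `y` nor adjacent to a vertex linked to `y`. In a
factorizable graph this says that `k` belongs to `C(G - y)`. -/
def Above {V : Type*} (G : SimpleGraph V) (y k : V) : Prop :=
  k ≠ y ∧ ¬ Linked G y k ∧ ∀ z, Linked G y z → ¬ G.Adj z k

/-- A vertex that is not linked to either end of a linked pair lies below it. -/
lemma Linked.above {v k k' : V} (h : Linked G k k') (hv : k ≠ v) (h1 : ¬ Linked G v k)
    (h2 : ¬ Linked G v k') : Above G v k := by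
  refine ⟨hv, h1, fun z hz hzk => ?_⟩
  have hzk' : z ≠ k' := fun e => h2 (e ▸ hz)
  have hvk' : v ≠ k' := fun e => h1 (e ▸ h.symm)
  rcases h.exchange hz hv hzk.ne' hvk'.symm hzk'.symm with h3 | h3 | h3
  · exact h2 h3.1
  · exact h1 h3.1
  · refine h2 ⟨hvk', (h3.diff_pair (x := z) (y := k) (by simp) (by simp) hzk).congr ?_⟩
    ext u; simp only [Set.mem_sdiff, Set.mem_insert_iff, Set.mem_singleton_iff]
    have := hzk.ne; have := h.1; have := hz.1
    grind

/-- The vertices above `v` form a union of components of the allowed graph. -/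
lemma Above.of_linked {v k w : V} (h : Above G v k) (hkw : Linked G k w) (hadj : G.Adj k w) :
    Above G v w := by
  have h1 : ¬ Linked G v w := fun hw => h.2.2 w hw hadj.symm
  exact hkw.symm.above (fun e => h.2.1 (e ▸ hkw.symm)) h1 h.2.1

lemma Above.of_reachable {v k w : V} (h : Above G v k) (hkw : (allowedGraph G).Reachable k w) :
    Above G v w := by
  rw [SimpleGraph.reachable_iff_reflTransGen] at hkw
  induction hkw with
  | refl => exact h
  | tail _ hadj ih =>
    rw [allowedGraph_adj] at hadj
    exact ih.of_linked hadj.2 hadj.1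

/-- In an elementary graph, not being linked is transitive (Kotzig). -/
lemma Elementary.not_linked_trans (hG : Elementary G) {x y z : V}
    (h1 : ¬ Linked G x y) (h2 : ¬ Linked G y z) (hxy : x ≠ y) : ¬ Linked G x z := fun h => by
  have := h.above (v := y) hxy (fun h' => h1 h'.symm) h2
  exact (this.of_reachable (hG.2.preconnected x y)).1 rfl

end Above

/-! ### Graphs in which no vertex lies above another are elementary -/

section Connected

variable {V : Type*} {G : SimpleGraph V}

lemma FactorizableOff.even_ncard [Finite V] {U : Set V} (h : FactorizableOff G U)
    (h₀ : FactorizableOff G ∅) : Even U.ncard := by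
  obtain ⟨m, hm⟩ := h
  obtain ⟨m₀, hm₀⟩ := h₀
  have h1 := hm.even_ncard (A := Uᶜ) disjoint_compl_left (fun v hv => hm.notMem hv)
  have h2 := hm₀.even_ncard (A := Set.univ) (by simp) (by simp)
  rw [Set.ncard_univ, ← Set.ncard_add_ncard_compl U, Nat.even_add] at h2
  exact h2.2 h1

/-- For a maximal barrier `B`, this relation on the complement of `B` plays the part of lying in the
same component of `G - B`. -/
def SameSide {V : Type*} (G : SimpleGraph V) (B : Set V) (c c' : V) : Prop :=
  ∀ b ∈ B, ∀ b' ∈ B, b ≠ b' → ¬ FactorizableOff G {b, b', c, c'}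

lemma SameSide.symm {B : Set V} {c c' : V} (h : SameSide G B c c') : SameSide G B c' c :=
  fun b hb b' hb' hne hF => h b hb b' hb' hne (hF.congr (by
    ext v; simp only [Set.mem_insert_iff, Set.mem_singleton_iff]; tauto))

/-- A set of pairwise unlinked vertices which are linked to all the other vertices. -/
structure IsFullBarrier {V : Type*} (G : SimpleGraph V) (B : Set V) : Prop where
  factorizable : FactorizableOff G ∅
  not_linked : ∀ b ∈ B, ∀ b' ∈ B, ¬ Linked G b b'
  linked : ∀ b ∈ B, ∀ c ∉ B, Linked G b c

/-- A perfect matching joins at most one vertex of the barrier to each side. -/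
lemma SameSide.eq_of_map {B : Set V} {m : V → V} (hm : IsMatchingMap G ∅ m) {b b' : V} (hb : b ∈ B)
    (hb' : b' ∈ B) (h : SameSide G B (m b) (m b')) : b = b' := by
  by_contra hne
  refine h b hb b' hb' hne ((hm.union (A := {b, b', m b, m b'}) ?_).congr (by simp))
  rintro v (rfl | rfl | rfl | rfl) <;> simp [hm.invol]

namespace IsFullBarrier

variable {B : Set V} {c c' c'' : V} {m : V → V}

lemma of_adj (hB : IsFullBarrier G B) (hc : c ∉ B) (hc' : c' ∉ B) (h : G.Adj c c') :
    SameSide G B c c' := by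
  intro b hb b' hb' hne hF
  refine hB.not_linked b hb b' hb' ⟨hne, (hF.diff_pair (x := c) (y := c') (by simp) (by simp)
    h).congr ?_⟩
  ext v
  simp only [Set.mem_sdiff, Set.mem_insert_iff, Set.mem_singleton_iff]
  grind

lemma map_notMem (hB : IsFullBarrier G B) (hm : IsMatchingMap G ∅ m) {b : V} (hb : b ∈ B) :
    m b ∉ B := fun h => hB.not_linked b hb _ h (hm.linked b)

variable [Finite V]

lemma refl (hB : IsFullBarrier G B) (hc : c ∉ B) : SameSide G B c c := by
  intro b hb b' hb' hne hF
  have h := hF.even_ncard hB.factorizable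
  have hbc : b ≠ c := fun e => hc (e ▸ hb)
  have hbc' : b' ≠ c := fun e => hc (e ▸ hb')
  rw [Set.pair_eq_singleton, Set.ncard_eq_three.2 ⟨b, b', c, hne, hbc, hbc', rfl⟩] at h
  exact absurd h (by decide)

lemma trans (hB : IsFullBarrier G B) (hc : c ∉ B) (hc' : c' ∉ B) (hc'' : c'' ∉ B)
    (h : SameSide G B c c') (h' : SameSide G B c' c'') : SameSide G B c c'' := by
  intro b hb b' hb' hne hF
  by_cases e : c' = c
  · exact (e ▸ h') b hb b' hb' hne hF
  by_cases e' : c' = c''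
  · exact (e' ▸ h) b hb b' hb' hne hF
  by_cases e'' : c = c''
  · exact hB.refl hc b hb b' hb' hne (e'' ▸ hF)
  have n1 : b ≠ c := fun e => hc (e ▸ hb)
  have n2 : b ≠ c' := fun e => hc' (e ▸ hb)
  have n3 : b ≠ c'' := fun e => hc'' (e ▸ hb)
  have n1' : b' ≠ c := fun e => hc (e ▸ hb')
  have n2' : b' ≠ c' := fun e => hc' (e ▸ hb')
  have n3' : b' ≠ c'' := fun e => hc'' (e ▸ hb')
  -- Exchange at `c'` with the linked pair `{b, c'}`.
  obtain ⟨d, hd, hdc, h1, h2⟩ := hF.exchange (hB.linked b hb c' hc').2 (a := c')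
    (Or.inr ⟨by simp, by simp only [Set.mem_insert_iff, Set.mem_singleton_iff]; grind⟩)
  have hd' : d = b' ∨ d = c ∨ d = c'' := by
    simp only [Set.mem_symmDiff, Set.mem_insert_iff, Set.mem_singleton_iff] at hd
    tauto
  rcases hd' with rfl | rfl | rfl
  · refine hB.not_linked b hb d hb' ⟨hne, h2.congr ?_⟩
    ext v; simp only [Set.mem_symmDiff, Set.mem_insert_iff, Set.mem_singleton_iff]; grind
  · refine h' b hb b' hb' hne (h1.congr ?_)
    ext v; simp only [Set.mem_symmDiff, Set.mem_insert_iff, Set.mem_singleton_iff]; grind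
  · refine h b hb b' hb' hne (h1.congr ?_)
    ext v; simp only [Set.mem_symmDiff, Set.mem_insert_iff, Set.mem_singleton_iff]; grind

/-- The sides are odd, being factor-critical. -/
lemma odd_side (hB : IsFullBarrier G B) {s : V} (hs : s ∈ B) (hc : c ∉ B) :
    Odd {z | z ∉ B ∧ SameSide G B c z}.ncard := by
  obtain ⟨m, hm⟩ := (hB.linked s hs c hc).2
  have hcZ : c ∈ {z | z ∉ B ∧ SameSide G B c z} := ⟨hc, hB.refl hc⟩
  have h1 : Even ({z | z ∉ B ∧ SameSide G B c z} \ {c}).ncard := by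
    refine hm.even_ncard ?_ ?_
    · rw [Set.disjoint_left]
      rintro z ⟨⟨hz, -⟩, hzc⟩ (rfl | rfl)
      · exact hz hs
      · exact hzc rfl
    · rintro z ⟨⟨hz, hcz⟩, hzc⟩
      have hzU : z ∉ ({s, c} : Set V) := by
        rintro (rfl | rfl)
        · exact hz hs
        · exact hzc rfl
      have hmz := hm.notMem hzU
      simp only [Set.mem_insert_iff, Set.mem_singleton_iff, not_or] at hmz
      have hmB : m z ∉ B := fun h => by
        refine hcz s hs (m z) h (fun e => hmz.1 e.symm) ((hm.union_pair z).congr ?_)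
        ext v; simp only [Set.mem_union, Set.mem_insert_iff, Set.mem_singleton_iff]; tauto
      exact ⟨⟨hmB, hB.trans hc hz hmB hcz (hB.of_adj hz hmB (hm.adj z hzU))⟩, hmz.2⟩
  rw [← Set.ncard_sdiff_singleton_add_one hcZ]
  exact h1.add_one

/-- A perfect matching joins some vertex of the barrier to each side. -/
lemma exists_sameSide (hB : IsFullBarrier G B) (hm : IsMatchingMap G ∅ m) {s : V} (hs : s ∈ B)
    (hc : c ∉ B) : ∃ b ∈ B, SameSide G B c (m b) := by
  by_contra! hcon
  refine Nat.not_even_iff_odd.2 (hB.odd_side hs hc) (hm.even_ncard (by simp) ?_)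
  rintro z ⟨hz, hcz⟩
  have hmB : m z ∉ B := fun h => hcon _ h (by rwa [hm.invol])
  exact ⟨hmB, hB.trans hc hz hmB hcz (hB.of_adj hz hmB (hm.adj z (by simp)))⟩

/-- Let `K` be closed under a perfect matching. Then the parity of the part of a side in `K` tells
whether the barrier vertex matched to this side belongs to `K`. -/
lemma odd_side_inter (hB : IsFullBarrier G B) (hm : IsMatchingMap G ∅ m) {K : Set V}
    (hK : ∀ v ∈ K, m v ∈ K) {b : V} (hb : b ∈ B) :
    Odd {z | (z ∉ B ∧ SameSide G B (m b) z) ∧ z ∈ K}.ncard ↔ b ∈ K := by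
  have hmb := hB.map_notMem hm hb
  have hsub : ∀ v, (v ∉ B ∧ SameSide G B (m b) v) → v ∈ K →
      ¬ ((m v ∉ B ∧ SameSide G B (m b) (m v)) ∧ m v ∈ K) → v = m b := by
    intro v hv hvK hmv
    have hB' : m v ∈ B := by
      by_contra hmB
      exact hmv ⟨⟨hmB, hB.trans hmb hv.1 hmB hv.2 (hB.of_adj hv.1 hmB (hm.adj v (by simp)))⟩,
        hK v hvK⟩
    rw [SameSide.eq_of_map hm hb hB' (by rw [hm.invol]; exact hv.2), hm.invol]
  rw [← Nat.not_even_iff_odd, hm.even_ncard_iff _ (by simp)]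
  by_cases hbK : b ∈ K
  · have : {v ∈ {z | (z ∉ B ∧ SameSide G B (m b) z) ∧ z ∈ K} |
        m v ∉ {z | (z ∉ B ∧ SameSide G B (m b) z) ∧ z ∈ K}} = {m b} := by
      ext v
      simp only [Set.mem_ofPred_eq, Set.mem_singleton_iff]
      refine ⟨fun h => hsub v h.1.1 h.1.2 h.2, ?_⟩
      rintro rfl
      exact ⟨⟨⟨hmb, hB.refl hmb⟩, hK b hbK⟩, fun h => h.1.1 (by rwa [hm.invol])⟩
    rw [this]
    simp [hbK]
  · have : {v ∈ {z | (z ∉ B ∧ SameSide G B (m b) z) ∧ z ∈ K} |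
        m v ∉ {z | (z ∉ B ∧ SameSide G B (m b) z) ∧ z ∈ K}} = ∅ := by
      ext v
      simp only [Set.mem_ofPred_eq, Set.mem_empty_iff_false, iff_false]
      intro h
      have := hsub v h.1.1 h.1.2 h.2
      subst this
      exact hbK (by simpa [hm.invol] using hK _ h.1.2)
    rw [this]
    simp [hbK]

lemma mem_iff_of_sameSide (hB : IsFullBarrier G B) {m' : V → V} (hm : IsMatchingMap G ∅ m)
    (hm' : IsMatchingMap G ∅ m') {K : Set V} (hK : ∀ v ∈ K, m v ∈ K) (hK' : ∀ v ∈ K, m' v ∈ K)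
    {b b' : V} (hb : b ∈ B) (hb' : b' ∈ B) (h : SameSide G B (m b) (m' b')) :
    b ∈ K ↔ b' ∈ K := by
  have h1 := hB.map_notMem hm hb
  have h2 := hB.map_notMem hm' hb'
  have : {z | (z ∉ B ∧ SameSide G B (m b) z) ∧ z ∈ K} =
      {z | (z ∉ B ∧ SameSide G B (m' b') z) ∧ z ∈ K} := by
    ext z
    simp only [Set.mem_ofPred_eq]
    refine and_congr_left fun _ => and_congr_right fun hz => ?_
    exact ⟨hB.trans h2 h1 hz h.symm, hB.trans h1 h2 hz h⟩
  rw [← hB.odd_side_inter hm hK hb, this, hB.odd_side_inter hm' hK' hb']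

/-- A full barrier does not meet both a set closed under allowed edges and its complement. -/
lemma mem_of_mem (hB : IsFullBarrier G B) {K : Set V}
    (hK : ∀ x y, Linked G x y → G.Adj x y → (x ∈ K ↔ y ∈ K)) {s b₀ : V} (hs : s ∈ B)
    (hb₀ : b₀ ∈ B) (hsK : s ∈ K) : b₀ ∈ K := by
  classical
  by_contra hb₀K
  have hcl : ∀ {m}, IsMatchingMap G ∅ m → ∀ v ∈ K, m v ∈ K := fun {m} hm v hv =>
    (hK _ _ (hm.linked v) (hm.adj v (by simp))).1 hv
  obtain ⟨n, hn⟩ := hB.factorizable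
  have ht := hB.map_notMem hn hb₀
  have hst := hB.linked s hs _ ht
  obtain ⟨m, hm⟩ := hst.2
  -- Away from `s` and `n b₀`, the matching `m` sends the rest of the barrier out of the barrier.
  have hF : ∀ b ∈ B, b ≠ s → FactorizableOff G {s, n b₀, b, m b} ∧ m b ∉ ({s, n b₀} : Set V) := by
    intro b hb hbs
    refine ⟨(hm.union_pair b).congr ?_, hm.notMem ?_⟩
    · ext v; simp only [Set.mem_union, Set.mem_insert_iff, Set.mem_singleton_iff]; tauto
    · rintro (rfl | rfl)
      · exact hbs rfl
      · exact ht hb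
  have hadj : ∀ b ∈ B, b ≠ s → G.Adj b (m b) := fun b hb hbs => hm.adj b (by
    rintro (rfl | rfl)
    · exact hbs rfl
    · exact ht hb)
  have hmB : ∀ b ∈ B, b ≠ s → m b ∉ B := by
    intro b hb hbs hmb
    obtain ⟨d, hd, hdb, h1, h2⟩ := FactorizableOff.exists_pair hB.factorizable (hF b hb hbs).1
      (a := b) (by simp)
    have hdB : d ∉ B := fun h => hB.not_linked b hb d h ⟨hdb.symm, h1⟩
    have hd' : d = n b₀ := by
      rcases hd with rfl | rfl | rfl | rfl
      · exact absurd hs hdB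
      · rfl
      · exact absurd rfl hdb
      · exact absurd hmb hdB
    subst hd'
    have hne := (hF b hb hbs).2
    simp only [Set.mem_insert_iff, Set.mem_singleton_iff, not_or] at hne
    refine hB.not_linked s hs _ hmb ⟨fun e => hne.1 e.symm, h2.congr ?_⟩
    have := (hadj b hb hbs).ne
    have := hst.1
    ext v; simp only [Set.mem_sdiff, Set.mem_insert_iff, Set.mem_singleton_iff]; grind
  have hside₀ : ∀ b ∈ B, b ≠ s → ¬ SameSide G B (n b₀) (m b) := fun b hb hbs h =>
    h s hs b hb hbs.symm ((hF b hb hbs).1.congr (by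
      ext v; simp only [Set.mem_insert_iff, Set.mem_singleton_iff]; tauto))
  have hside : ∀ b ∈ B, ∀ b' ∈ B, b ≠ s → b' ≠ s → b ≠ b' → ¬ SameSide G B (m b) (m b') := by
    intro b hb b' hb' hbs hbs' hne h
    have k1 := hmB b hb hbs
    have k2 := hmB b' hb' hbs'
    have k3 := (hF b hb hbs).2
    have k4 := (hF b' hb' hbs').2
    simp only [Set.mem_insert_iff, Set.mem_singleton_iff, not_or] at k3 k4
    have hne' : m b ≠ m b' := fun e => hne (hm.inj e)
    have j1 : b ≠ m b := (hadj b hb hbs).ne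
    have j2 : b ≠ m b' := fun e => k2 (e ▸ hb)
    have j3 : b' ≠ m b := fun e => k1 (e ▸ hb')
    have j4 : b' ≠ m b' := (hadj b' hb' hbs').ne
    have j5 : b ≠ n b₀ := fun e => ht (e ▸ hb)
    have j6 : b' ≠ n b₀ := fun e => ht (e ▸ hb')
    have j7 := hst.1
    have hU : FactorizableOff G {s, n b₀, b, b', m b, m b'} := by
      refine (hm.union (A := {b, b', m b, m b'}) ?_).congr ?_
      · rintro v (rfl | rfl | rfl | rfl) <;> simp [hm.invol]
      · ext v; simp only [Set.mem_union, Set.mem_insert_iff, Set.mem_singleton_iff]; tauto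
    -- Exchange at `s` with the linked pair `{b, m b}`.
    obtain ⟨d, hd, hds, h1, h2⟩ := hU.exchange (hB.linked b hb _ k1).2 (a := s)
      (Or.inl ⟨by simp, by simp only [Set.mem_insert_iff, Set.mem_singleton_iff]; grind⟩)
    have hd' : d = n b₀ ∨ d = b' ∨ d = m b' := by
      simp only [Set.mem_symmDiff, Set.mem_insert_iff, Set.mem_singleton_iff] at hd
      tauto
    rcases hd' with rfl | rfl | rfl
    · refine h b hb b' hb' hne (h1.congr ?_)
      ext v; simp only [Set.mem_symmDiff, Set.mem_insert_iff, Set.mem_singleton_iff]; grind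
    · obtain ⟨e, he, hes, h3, h4⟩ := FactorizableOff.exists_pair hB.factorizable h2 (a := s)
        (by simp only [Set.mem_symmDiff, Set.mem_insert_iff, Set.mem_singleton_iff]; grind)
      have heB : e ∉ B := fun h => hB.not_linked s hs e h ⟨hes.symm, h3⟩
      have he' : e = m b := by
        simp only [Set.mem_symmDiff, Set.mem_insert_iff, Set.mem_singleton_iff] at he
        grind
      subst he'
      refine hB.not_linked b hb d hb' ⟨hne, h4.congr ?_⟩
      ext v
      simp only [Set.mem_symmDiff, Set.mem_sdiff, Set.mem_insert_iff, Set.mem_singleton_iff]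
      grind
    · refine h b hb s hs hbs (h2.congr ?_)
      ext v; simp only [Set.mem_symmDiff, Set.mem_insert_iff, Set.mem_singleton_iff]; grind
  -- Send `b` to the barrier vertex which `n` matches to the side of `m b`.
  have hg : ∀ b : {b // b ∈ B ∧ b ∉ K}, ∃ b' : {b // b ∈ B ∧ b ∉ K},
      SameSide G B (m b) (n b') := by
    rintro ⟨b, hb, hbK⟩
    have hbs : b ≠ s := fun e => hbK (e ▸ hsK)
    obtain ⟨n', hn', hnb⟩ := (hB.linked b hb _ (hmB b hb hbs)).exists_isMatchingMap (hadj b hb hbs)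
    obtain ⟨b', hb', h⟩ := hB.exists_sameSide hn hs (hmB b hb hbs)
    refine ⟨⟨b', hb', fun h' => hbK ?_⟩, h⟩
    exact (hB.mem_iff_of_sameSide hn' hn (hcl hn') (hcl hn) hb hb' (hnb.symm ▸ h)).2 h'
  choose g hg using hg
  have hginj : Function.Injective g := by
    intro b b' e
    by_contra hne
    have hbs : (b : V) ≠ s := fun e => b.2.2 (e ▸ hsK)
    have hbs' : (b' : V) ≠ s := fun e => b'.2.2 (e ▸ hsK)
    refine hside b b.2.1 b' b'.2.1 hbs hbs' (fun h => hne (Subtype.ext h)) ?_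
    have h1 := hg b'
    rw [← e] at h1
    exact hB.trans (hmB _ b.2.1 hbs) (hB.map_notMem hn (g b).2.1) (hmB _ b'.2.1 hbs') (hg b)
      h1.symm
  obtain ⟨b, hb⟩ := (Finite.injective_iff_surjective.1 hginj) ⟨b₀, hb₀, hb₀K⟩
  have hbs : (b : V) ≠ s := fun e => b.2.2 (e ▸ hsK)
  have h1 := hg b
  rw [hb] at h1
  exact hside₀ b b.2.1 hbs h1.symm

end IsFullBarrier

/-- A factorizable graph in which no vertex lies above another is elementary. -/
theorem connected_allowedGraph_of_not_above [Finite V] [Nonempty V] (h₀ : FactorizableOff G ∅)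
    (hAb : ∀ y k, ¬ Above G y k) :
    (allowedGraph G).Connected := by
  rw [SimpleGraph.connected_iff]
  refine ⟨fun u v => ?_, inferInstance⟩
  by_contra huv
  set K : Set V := {w | (allowedGraph G).Reachable u w} with hKdef
  have hK : ∀ x y, Linked G x y → G.Adj x y → (x ∈ K ↔ y ∈ K) := fun x y h1 h2 => by
    have := (allowedGraph_adj.2 ⟨h2, h1⟩).reachable
    exact ⟨fun h => SimpleGraph.Reachable.trans h this,
      fun h => SimpleGraph.Reachable.trans h this.symm⟩
  have huK : u ∈ K := SimpleGraph.Reachable.refl u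
  have hvK : v ∉ K := huv
  have htrans : ∀ {x y z}, x ≠ y → ¬ Linked G x y → Linked G x z → Linked G y z :=
    fun {x y z} hxy h1 h2 => by
      by_contra h3
      exact hAb y x (h2.above hxy (fun h => h1 h.symm) h3)
  by_cases hex : ∃ s ∈ K, ∃ b ∉ K, ¬ Linked G s b
  · obtain ⟨s, hs, b, hb, hsb⟩ := hex
    have hB : IsFullBarrier G {x | ¬ Linked G s x} := by
      refine ⟨h₀, fun x hx y hy hxy => ?_, fun x hx y hy => ?_⟩
      · by_cases e : s = x
        · exact hy (e ▸ hxy)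
        · exact hy (htrans (fun e' => e e'.symm) (fun h => hx h.symm) hxy)
      · simp only [Set.mem_ofPred_eq, not_not] at hx hy
        by_cases e : s = x
        · exact e ▸ hy
        · exact htrans e hx hy
    exact hb (hB.mem_of_mem hK (s := s) (fun h => h.1 rfl) hsb hs)
  · push Not at hex
    obtain ⟨n, hn⟩ := h₀
    obtain ⟨m, hm⟩ := (hex u huK v hvK).2
    have hmem : ∀ {x y}, G.Adj x y → x ∈ K → y ∈ K := fun {x y} h hx => by
      by_contra hy
      exact hy ((hK x y (hex x hx y hy) h).1 hx)
    have h1 := hn.even_ncard (A := K) (by simp) (fun x hx => hmem (hn.adj x (by simp)) hx)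
    have h2 : Even (K \ {u}).ncard := by
      refine hm.even_ncard ?_ ?_
      · rw [Set.disjoint_left]
        rintro x ⟨hx, hxu⟩ (rfl | rfl)
        · exact hxu rfl
        · exact hvK hx
      · rintro x ⟨hx, hxu⟩
        have hx' : x ∉ ({u, v} : Set V) := by
          rintro (rfl | rfl)
          · exact hxu rfl
          · exact hvK hx
        exact ⟨hmem (hm.adj x hx') hx, fun e => hm.notMem hx' (Or.inl e)⟩
    rw [← Set.ncard_sdiff_singleton_add_one huK, Nat.even_add_one] at h1
    exact h1 h2

end Connected

/-! ### The structure of a saturated graph -/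

/-- A vertex with no vertex below it. -/
def IsBottom {V : Type*} (G : SimpleGraph V) (v : V) : Prop :=
  ∀ y, ¬ Above G y v

section Structure

variable {V : Type*} [Finite V] {G : SimpleGraph V}

lemma Saturated.factorizableOff (hG : Saturated G) : FactorizableOff G ∅ := (saturated_iff.1 hG).1

lemma Saturated.adj_of_not_linked (hG : Saturated G) {x y : V} (hne : x ≠ y)
    (h : ¬ Linked G x y) : G.Adj x y := by
  by_contra hadj
  exact h ((saturated_iff.1 hG).2 x y hne hadj)

lemma Above.linked (hG : Saturated G) {y v z : V} (h : Above G y v) (hz : Linked G y z) :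
    Linked G v z := by
  by_contra hvz
  exact h.2.2 z hz (hG.adj_of_not_linked (by rintro rfl; exact h.2.1 hz) hvz).symm

lemma Above.ssubset (hG : Saturated G) {y v : V} (h : Above G y v) :
    {z | Linked G y z} ⊂ {z | Linked G v z} := by
  have hsub : {z | Linked G y z} ⊆ {z | Linked G v z} := fun z hz => h.linked hG hz
  obtain ⟨m, hm⟩ := hG.factorizableOff
  exact (Set.ssubset_iff_of_subset hsub).2 ⟨m v, hm.linked v, fun hz =>
    h.2.2 _ hz (hm.adj v (by simp)).symm⟩

lemma Above.trans (hG : Saturated G) {y v w : V} (h : Above G y v) (h' : Above G v w) :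
    Above G y w := by
  refine ⟨?_, fun hw => h'.2.1 (h.linked hG hw), fun z hz => h'.2.2 z (h.linked hG hz)⟩
  rintro rfl
  exact (h.ssubset hG).asymm (h'.ssubset hG)

/-- Every vertex is a bottom vertex or lies above one, by induction on the number of vertices linked
to it. -/
lemma exists_isBottom_above (hG : Saturated G) (n : ℕ) : ∀ k, {z | Linked G k z}.ncard ≤ n →
    IsBottom G k ∨ ∃ v, IsBottom G v ∧ Above G v k := by
  induction n with
  | zero =>
    intro k hk
    refine Or.inl fun y hy => ?_
    have := Set.ncard_lt_ncard (hy.ssubset hG)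
    omega
  | succ n ih =>
    intro k hk
    by_cases hb : IsBottom G k
    · exact Or.inl hb
    · simp only [IsBottom, not_forall, not_not] at hb
      obtain ⟨y, hy⟩ := hb
      have := Set.ncard_lt_ncard (hy.ssubset hG)
      rcases ih y (by omega) with h | ⟨v, hv, hvy⟩
      · exact Or.inr ⟨y, h, hy⟩
      · exact Or.inr ⟨v, hv, hvy.trans hG hy⟩

lemma isBottom_or_above (hG : Saturated G) (k : V) :
    IsBottom G k ∨ ∃ v, IsBottom G v ∧ Above G v k :=
  exists_isBottom_above hG _ k le_rfl

namespace IsBottom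

/-- A vertex which is not linked to a bottom vertex is linked to whatever this one is linked to. -/
lemma linked {v x z : V} (hv : IsBottom G v) (h : ¬ Linked G x v) (hz : Linked G v z)
    (hne : x ≠ v) : Linked G x z := by
  by_contra hxz
  exact hv x (hz.above hne.symm h hxz)

lemma of_linked {k w : V} (hk : IsBottom G k) (h : Linked G k w) (hadj : G.Adj k w) :
    IsBottom G w := fun y hy => hk y (hy.of_linked h.symm hadj.symm)

lemma linked_iff {v v' z : V} (hv : IsBottom G v) (hv' : IsBottom G v') (h : ¬ Linked G v v') :
    Linked G v z ↔ Linked G v' z := by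
  by_cases e : v = v'
  · rw [e]
  · exact ⟨fun hz => hv.linked (fun h' => h h'.symm) hz (Ne.symm e), fun hz => hv'.linked h hz e⟩

lemma above_of_above {v v' x : V} (hv : IsBottom G v) (hv' : IsBottom G v')
    (h : ¬ Linked G v v') (hx : Above G v x) : Above G v' x := by
  refine ⟨fun e => hv' v (e ▸ hx), fun h' => hx.2.1 ((hv.linked_iff hv' h).2 h'),
    fun z hz => hx.2.2 z ((hv.linked_iff hv' h).2 hz)⟩

/-- Towers over different classes are disjoint. -/
lemma not_linked_of_above (hG : Saturated G) {v v' x : V} (h : Above G v x) (h' : Above G v' x) :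
    ¬ Linked G v v' := fun hl =>
  h.2.2 v' hl (hG.adj_of_not_linked h'.1.symm h'.2.1)

/-- There are no edges between towers over different classes. -/
lemma not_adj_of_above {v v' x x' : V} (hv' : IsBottom G v')
    (hl : Linked G v v') (hx : Above G v x) (hx' : Above G v' x') : ¬ G.Adj x x' := fun hadj =>
  hx.2.2 x' (hv'.linked (fun h => hx'.2.1 h.symm) hl.symm hx'.1).symm hadj.symm

/-- A tower is completely joined to its class and to no other vertex of the foundation. -/
lemma adj_iff (hG : Saturated G) {u v x : V} (hu : IsBottom G u) (hv : IsBottom G v)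
    (hx : Above G v x) : G.Adj u x ↔ ¬ Linked G v u := by
  refine ⟨fun hadj hl => hx.2.2 u hl hadj, fun hl => ?_⟩
  have := hv.above_of_above hu hl hx
  exact hG.adj_of_not_linked this.1.symm this.2.1

lemma of_adj_tower (hG : Saturated G) {v c w : V} (hv : IsBottom G v) (hc : Above G v c)
    (hcw : G.Adj c w) (hw : ¬ Above G v w) : IsBottom G w ∧ ¬ Linked G v w := by
  rcases isBottom_or_above hG w with h | ⟨v', hv', h⟩
  · exact ⟨h, (h.adj_iff hG hv hc).1 hcw.symm⟩
  · by_cases hl : Linked G v v'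
    · exact absurd hcw (hv'.not_adj_of_above hl hc h)
    · exact absurd (hv'.above_of_above hv (fun h' => hl h'.symm) h) hw

/-- A matching that misses only vertices of a tower does not leave the tower. -/
lemma factorizableOff_tower (hG : Saturated G) {v : V} (hv : IsBottom G v) {U : Set V}
    (hU : ∀ u ∈ U, Above G v u) (h : FactorizableOff G U) :
    FactorizableOff G ({x | Above G v x}ᶜ ∪ U) := by
  obtain ⟨m, hm⟩ := h
  refine (hm.restrict {x | Above G v x}).congr ?_
  have : {c ∈ {x | Above G v x} | m c ∉ {x | Above G v x}} = ∅ := by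
    rw [Set.eq_empty_iff_forall_notMem]
    rintro c ⟨hc, hmc⟩
    simp only [Set.mem_ofPred_eq] at hc hmc
    have hcU : c ∉ U := fun h => hmc (by rwa [hm.fixed c h])
    obtain ⟨hs, hvs⟩ := hv.of_adj_tower hG hc (hm.adj c hcU) hmc
    -- The partner of `c` is linked to no vertex of the tower, so it cannot be exchanged.
    obtain ⟨b, hb, hbs, hl, -⟩ := FactorizableOff.exists_pair hG.factorizableOff (hm.union_pair c)
      (a := m c) (by simp)
    have hb' : Above G v b := by
      rcases hb with hb | rfl | rfl
      · exact hU b hb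
      · exact hc
      · exact absurd rfl hbs
    exact (hv.above_of_above hs hvs hb').2.1 ⟨hbs.symm, hl⟩
  rw [this, Set.union_empty]

/-- A matching that misses only vertices of the foundation can be replaced by one that stays in the
foundation: the classes are cliques and the towers are even. -/
lemma factorizableOff_foundation (hG : Saturated G) {U : Set V} (hU : ∀ u ∈ U, IsBottom G u)
    (h : FactorizableOff G U) : FactorizableOff G ({x | IsBottom G x}ᶜ ∪ U) := by
  obtain ⟨m, hm⟩ := h
  obtain ⟨n, hn⟩ := hG.factorizableOff
  have hℓ : ∀ {x y}, {z | Linked G x z} = {z | Linked G y z} → ¬ Linked G x y := by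
    intro x y e hl
    have : y ∈ {z | Linked G y z} := e ▸ hl
    exact this.1 rfl
  refine hm.factorizableOff_of_towers (fun x => {z | Linked G x z})
    (tw := fun i => {c | ∃ v, IsBottom G v ∧ {z | Linked G v z} = i ∧ Above G v c})
    (fun x _ y _ hne e => hG.adj_of_not_linked hne (hℓ e)) (fun i => ?_) (fun i => ?_) ?_ ?_ ?_
  · refine hn.even_ncard (by simp) ?_
    rintro c ⟨v, hv, e, hc⟩
    exact ⟨v, hv, e, hc.of_linked (hn.linked c) (hn.adj c (by simp))⟩
  · rw [Set.disjoint_iff_inter_eq_empty.1, Set.ncard_empty]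
    · exact Even.zero
    · rw [Set.disjoint_left]
      rintro c ⟨v, -, -, hc⟩ hcU
      exact hU c hcU v hc
  · rintro i c ⟨v, -, -, hc⟩ hb
    exact hb v hc
  · intro s hs hms
    have hsU : s ∉ U := fun h => hms (by rwa [hm.fixed s h])
    obtain ⟨v, hv, h⟩ := (isBottom_or_above hG (m s)).resolve_left hms
    exact ⟨s, hs, rfl, hv.above_of_above hs ((hs.adj_iff hG hv h).1 (hm.adj s hsU)) h⟩
  · rintro i c ⟨v, hv, rfl, hc⟩ hcU hmc
    obtain ⟨h1, h2⟩ := hv.of_adj_tower hG hc (hm.adj c hcU) (fun h => hmc ⟨v, hv, rfl, h⟩)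
    refine ⟨h1, ?_⟩
    ext z
    exact (hv.linked_iff h1 h2).symm

lemma factorizableOff_foundation_iff (hG : Saturated G) {U : Set V}
    (hU : ∀ u ∈ U, IsBottom G u) :
    FactorizableOff G ({x | IsBottom G x}ᶜ ∪ U) ↔ FactorizableOff G U := by
  refine ⟨fun h => ?_, factorizableOff_foundation hG hU⟩
  obtain ⟨n, hn⟩ := hG.factorizableOff
  exact hn.factorizableOff_of_closed (fun x hx => IsBottom.of_linked hx (hn.linked x)
    (hn.adj x (by simp))) hU h

end IsBottom

/-- The foundation: the subgraph induced by the bottom vertices. -/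
abbrev bottomGraph {V : Type*} (G : SimpleGraph V) : SimpleGraph {x | IsBottom G x} :=
  G.induce {x | IsBottom G x}

lemma linked_bottomGraph_iff (hG : Saturated G) {x y : {x | IsBottom G x}} :
    Linked (bottomGraph G) x y ↔ Linked G x y := by
  rw [linked_induce_iff, IsBottom.factorizableOff_foundation_iff hG, Linked]
  rintro u (rfl | rfl)
  · exact x.2
  · exact y.2

lemma saturated_bottomGraph (hG : Saturated G) : Saturated (bottomGraph G) := by
  rw [saturated_iff]
  refine ⟨factorizableOff_induce_iff.2 ?_, fun x y hne hadj => ?_⟩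
  · rw [Set.image_empty, IsBottom.factorizableOff_foundation_iff hG (by simp)]
    exact hG.factorizableOff
  · rw [linked_bottomGraph_iff hG]
    by_contra h
    exact hadj (hG.adj_of_not_linked (fun e => hne (Subtype.ext e)) h)

lemma connected_allowedGraph_bottomGraph [Nonempty V] (hG : Saturated G) :
    (allowedGraph (bottomGraph G)).Connected := by
  have hne : Nonempty {x | IsBottom G x} := by
    obtain ⟨v⟩ := ‹Nonempty V›
    rcases isBottom_or_above hG v with h | ⟨w, hw, -⟩
    · exact ⟨v, h⟩
    · exact ⟨w, hw⟩
  refine connected_allowedGraph_of_not_above (saturated_bottomGraph hG).factorizableOff ?_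
  rintro y k ⟨hne, hl, hz⟩
  obtain ⟨n, hn⟩ := hG.factorizableOff
  have hkn := hn.linked k
  have hb := k.2.of_linked hkn (hn.adj k (by simp))
  rw [linked_bottomGraph_iff hG] at hl
  refine hz ⟨n k, hb⟩ ?_ (hn.adj k (by simp)).symm
  rw [linked_bottomGraph_iff hG]
  exact k.2.linked hl hkn (fun e => hne (Subtype.ext e.symm))

lemma saturated_tower (hG : Saturated G) {v : V} (hv : IsBottom G v) :
    Saturated (G.induce {x | Above G v x}) := by
  rw [saturated_iff]
  refine ⟨factorizableOff_induce_iff.2 ?_, fun x y hne hadj => ?_⟩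
  · rw [Set.image_empty]
    exact hv.factorizableOff_tower hG (by simp) hG.factorizableOff
  · have hne' : (x : V) ≠ y := fun e => hne (Subtype.ext e)
    refine linked_induce_iff.2 ⟨hne', hv.factorizableOff_tower hG ?_ ?_⟩
    · rintro u (rfl | rfl)
      · exact x.2
      · exact y.2
    · by_contra h
      exact hadj (hG.adj_of_not_linked hne' (fun h' => h h'.2))

end Structure

/-! ### The Gallai–Edmonds sets of `G - x` -/

section GallaiEdmonds

variable {V : Type*} {G : SimpleGraph V}

lemma SimpleGraph.Subgraph.IsMatching.ncard_verts [Finite V] {M : G.Subgraph} (hM : M.IsMatching) :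
    M.verts.ncard = 2 * M.edgeSet.ncard := by
  classical
  cases nonempty_fintype V
  have h := M.spanningCoe.sum_degrees_eq_twice_card_edges
  have hd : ∀ v, M.spanningCoe.degree v = if v ∈ M.verts then 1 else 0 := fun v => by
    split_ifs with hv
    · rw [SimpleGraph.degree_eq_one_iff_existsUnique_adj]
      exact hM hv
    · rw [← SimpleGraph.card_neighborFinset_eq_degree, Finset.card_eq_zero,
        Finset.eq_empty_iff_forall_notMem]
      intro w hw
      rw [SimpleGraph.mem_neighborFinset] at hw
      exact hv (M.edge_vert hw)
  simp only [hd, Finset.sum_boole, Nat.cast_id] at h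
  rw [Set.ncard_eq_toFinset_card', Set.ncard_eq_toFinset_card']
  convert h using 2
  · ext v; simp
  · congr 1
    ext e
    simp

lemma SimpleGraph.Subgraph.IsMatching.factorizableOff {M : G.Subgraph} (hM : M.IsMatching) :
    FactorizableOff G M.vertsᶜ := by
  classical
  have h : ∀ v, ∃ w, (v ∈ M.verts → M.Adj v w) ∧ (v ∉ M.verts → w = v) := fun v => by
    by_cases hv : v ∈ M.verts
    · obtain ⟨w, hw, -⟩ := hM hv
      exact ⟨w, fun _ => hw, fun h => absurd hv h⟩
    · exact ⟨v, fun h => absurd h hv, fun _ => rfl⟩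
  choose m hm hm' using h
  refine ⟨m, fun v => ?_, fun v hv => hm' v hv, fun v hv => (hm v (not_not.1 hv)).adj_sub⟩
  by_cases hv : v ∈ M.verts
  · have h1 := hm v hv
    exact hM.eq_of_adj_left (hm _ (M.edge_vert h1.symm)) h1.symm
  · rw [hm' v hv, hm' v hv]

lemma FactorizableOff.exists_isMatching {U : Set V} (h : FactorizableOff G U) :
    ∃ M : G.Subgraph, M.IsMatching ∧ M.verts = Uᶜ := by
  obtain ⟨m, hm⟩ := h
  refine ⟨{ verts := Uᶜ, Adj := fun v w => v ∉ U ∧ m v = w, adj_sub := ?_, edge_vert := ?_,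
            symm := ⟨?_⟩ }, ?_, rfl⟩
  · rintro v _ ⟨hv, rfl⟩
    exact hm.adj v hv
  · exact fun h => h.1
  · rintro v _ ⟨hv, rfl⟩
    exact ⟨hm.notMem hv, hm.invol v⟩
  · exact fun v hv => ⟨m v, ⟨hv, rfl⟩, fun w hw => hw.2.symm⟩

variable [Finite V]

lemma mem_gallaiD_delete_iff (h₀ : FactorizableOff G ∅) {x : V} (z : ({x}ᶜ : Set V)) :
    z ∈ gallaiD (G.induce ({x}ᶜ : Set V)) ↔ Linked G x z := by
  have hset : ∀ z : ({x}ᶜ : Set V), FactorizableOff (G.induce ({x}ᶜ : Set V)) {z} ↔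
      Linked G x z := fun z => by
    rw [factorizableOff_induce_iff, compl_compl, Set.image_singleton, Linked]
    exact ⟨fun h => ⟨fun e => z.2 e.symm, h⟩, fun h => h.2⟩
  obtain ⟨m, hm⟩ := h₀
  -- A maximum matching of `G - x` misses exactly one vertex.
  have hlow : ∀ M : (G.induce ({x}ᶜ : Set V)).Subgraph, IsMaximumMatching M →
      M.vertsᶜ.ncard ≤ 1 := by
    rintro M ⟨hM, hmax⟩
    obtain ⟨M', hM', hv⟩ := ((hset ⟨m x, (hm.linked x).1.symm⟩).2 (hm.linked x)).exists_isMatching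
    have h1 := hmax M' hM'
    have h2 := hM.ncard_verts
    have h3 := hM'.ncard_verts
    have h4 := Set.ncard_add_ncard_compl M.verts
    have h5 := Set.ncard_add_ncard_compl M'.verts
    have h6 : M'.vertsᶜ.ncard = 1 := by rw [hv, compl_compl, Set.ncard_singleton]
    omega
  constructor
  · rintro ⟨M, hM, hz⟩
    have : M.vertsᶜ = {z} := Set.eq_singleton_iff_unique_mem.2
      ⟨hz, fun w hw => (Set.ncard_le_one (Set.toFinite _)).1 (hlow M hM) w hw z hz⟩
    exact (hset z).1 (this ▸ hM.1.factorizableOff)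
  · intro h
    obtain ⟨M, hM, hv⟩ := ((hset z).2 h).exists_isMatching
    refine ⟨M, ⟨hM, fun M' hM' => ?_⟩, by simp [hv]⟩
    have h2 := hM.ncard_verts
    have h3 := hM'.ncard_verts
    have h4 := Set.ncard_add_ncard_compl M.verts
    have h5 := Set.ncard_add_ncard_compl M'.verts
    have h6 : M.vertsᶜ.ncard = 1 := by rw [hv, compl_compl, Set.ncard_singleton]
    omega

/-- For factorizable `G`, the set `C(G - x)` consists of the vertices above `x`. -/
lemma gallaiCDelete_eq (h₀ : FactorizableOff G ∅) (x : V) :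
    gallaiCDelete G x = {v | Above G x v} := by
  ext v
  simp only [gallaiCDelete, gallaiC, gallaiA, Set.mem_image, Set.mem_sdiff, Set.mem_univ, true_and,
    Set.mem_union, Set.mem_ofPred_eq, mem_gallaiD_delete_iff h₀, not_or, not_and, not_exists]
  constructor
  · rintro ⟨v, ⟨h1, h2⟩, rfl⟩
    exact ⟨v.2, h1, fun z hz hadj => h2 h1 ⟨z, hz.1.symm⟩ hz hadj⟩
  · rintro ⟨h1, h2, h3⟩
    exact ⟨⟨v, h1⟩, ⟨h2, fun _ z hz hadj => h3 z hz hadj⟩, rfl⟩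

end GallaiEdmonds

/-! ### Decompositions of the vertex set into a foundation and towers -/

/-- The description of a cathedral inside its own vertex set: `A` is the vertex set of the
foundation, `cls i` are the classes of its canonical partition, and `tw i` is the vertex set of the
tower over `cls i`. -/
structure IsDecomposition {V : Type*} (G : SimpleGraph V) (A : Set V) {ι : Type*}
    (cls tw : ι → Set V) : Prop where
  cover : ∀ v, v ∈ A ∨ ∃ i, v ∈ tw i
  disjoint : ∀ i, ∀ v ∈ tw i, v ∉ A
  eq_of_mem : ∀ i j, ∀ v ∈ tw i, v ∈ tw j → i = j
  cls_subset : ∀ i, cls i ⊆ A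
  cls_cover : ∀ v ∈ A, ∃ i, v ∈ cls i
  cls_nonempty : ∀ i, (cls i).Nonempty
  eq_of_mem_cls : ∀ i j, ∀ v ∈ cls i, v ∈ cls j → i = j
  mem_cls_iff : ∀ i, ∀ v ∈ cls i, ∀ w ∈ A, v ≠ w →
    (w ∈ cls i ↔ ¬ FactorizableOff G (Aᶜ ∪ {v, w}))
  adj_iff : ∀ i, ∀ v ∈ A, ∀ x ∈ tw i, (G.Adj v x ↔ v ∈ cls i)
  not_adj : ∀ i j, ∀ x ∈ tw i, ∀ y ∈ tw j, i ≠ j → ¬ G.Adj x y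
  factorizable_foundation : FactorizableOff G Aᶜ
  saturated_foundation : ∀ x ∈ A, ∀ y ∈ A, x ≠ y → ¬ G.Adj x y → FactorizableOff G (Aᶜ ∪ {x, y})
  factorizable_tower : ∀ i, FactorizableOff G (tw i)ᶜ
  saturated_tower : ∀ i, ∀ x ∈ tw i, ∀ y ∈ tw i, x ≠ y → ¬ G.Adj x y →
    FactorizableOff G ((tw i)ᶜ ∪ {x, y})

namespace IsDecomposition

variable {V : Type*} {G : SimpleGraph V} {A : Set V} {ι : Type*} {cls tw : ι → Set V}

/-- Perfect matchings of what is left of the foundation and the towers combine. -/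
lemma exists_glue (h : IsDecomposition G A cls tw) {U : Set V} (hA : FactorizableOff G (Aᶜ ∪ U))
    (htw : ∀ i, FactorizableOff G ((tw i)ᶜ ∪ U)) :
    ∃ m, IsMatchingMap G U m ∧ (∀ v ∈ A, m v ∈ A) ∧ ∀ i, ∀ v ∈ tw i, m v ∈ tw i := by
  classical
  have hex : ∀ v, ∃ o : Option ι, (v ∈ A ↔ o = none) ∧ ∀ i, v ∈ tw i ↔ o = some i := fun v => by
    rcases h.cover v with hv | ⟨i, hi⟩
    · exact ⟨none, by simp [hv], fun i => by simpa using fun hi => h.disjoint i v hi hv⟩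
    · exact ⟨some i, by simpa using h.disjoint i v hi, fun j => by
        simpa using ⟨fun hj => h.eq_of_mem i j v hi hj, fun e => e ▸ hi⟩⟩
  choose ℓ hℓ hℓ' using hex
  obtain ⟨m, hm, hml⟩ := FactorizableOff.exists_glue (G := G) (U := U) ℓ (fun o => by
    cases o with
    | none =>
      refine hA.congr ?_
      ext v; simp [hℓ]
    | some i =>
      refine (htw i).congr ?_
      ext v; simp [hℓ'])
  exact ⟨m, hm, fun v hv => by rwa [hℓ, hml, ← hℓ],
    fun i v hv => by rwa [hℓ', hml, ← hℓ']⟩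

lemma factorizableOff_tower_of_disjoint (h : IsDecomposition G A cls tw) {i : ι} {U : Set V}
    (hU : ∀ u ∈ U, u ∉ tw i) : FactorizableOff G ((tw i)ᶜ ∪ U) :=
  (h.factorizable_tower i).congr (Set.union_eq_left.2 hU).symm

lemma factorizableOff_foundation_of_disjoint (h : IsDecomposition G A cls tw) {U : Set V}
    (hU : ∀ u ∈ U, u ∉ A) : FactorizableOff G (Aᶜ ∪ U) :=
  h.factorizable_foundation.congr (Set.union_eq_left.2 hU).symm

/-- A matching of the foundation extends to the towers. -/
lemma extend_foundation (h : IsDecomposition G A cls tw) {U : Set V} (hU : U ⊆ A)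
    (hA : FactorizableOff G (Aᶜ ∪ U)) :
    ∃ m, IsMatchingMap G U m ∧ (∀ v ∈ A, m v ∈ A) ∧ ∀ i, ∀ v ∈ tw i, m v ∈ tw i :=
  h.exists_glue hA fun i => h.factorizableOff_tower_of_disjoint fun u hu hui =>
    h.disjoint i u hui (hU hu)

lemma exists_perfect (h : IsDecomposition G A cls tw) :
    ∃ m, IsMatchingMap G ∅ m ∧ (∀ v ∈ A, m v ∈ A) ∧ ∀ i, ∀ v ∈ tw i, m v ∈ tw i :=
  h.extend_foundation (Set.empty_subset _) (by simpa using h.factorizable_foundation)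

/-- Matching a vertex `s` of a class to a vertex `x` of its tower amounts to replacing `s` by the
partner of `x`. -/
lemma shift (h : IsDecomposition G A cls tw) {i : ι} {m : V → V} {U : Set V}
    (hm : IsMatchingMap G U m) {s x : V} (hs : s ∈ cls i) (hsU : s ∈ U) (hx : x ∈ tw i)
    (hxU : x ∉ U) (hmx : m x ∈ tw i) : FactorizableOff G (U \ {s} ∪ {m x}) := by
  have hsA := h.cls_subset i hs
  refine ((hm.union_pair x).diff_pair (x := s) (y := x) (by simp [hsU]) (by simp)
    ((h.adj_iff i s hsA x hx).2 hs)).congr ?_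
  have h1 : s ≠ m x := fun e => h.disjoint i _ hmx (e ▸ hsA)
  have h2 := (hm.adj x hxU).ne
  ext v
  simp only [Set.mem_sdiff, Set.mem_union, Set.mem_insert_iff, Set.mem_singleton_iff]
  grind

/-- Non-adjacent vertices of a cathedral are linked. -/
lemma linked_of_not_adj (h : IsDecomposition G A cls tw) {x y : V} (hne : x ≠ y)
    (hadj : ¬ G.Adj x y) : Linked G x y := by
  have hAt : ∀ i, ∀ x ∈ A, ∀ y ∈ tw i, ¬ G.Adj x y → Linked G x y := by
    intro i x hx y hy hadj
    obtain ⟨s, hs⟩ := h.cls_nonempty i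
    have hxs : x ∉ cls i := fun h' => hadj ((h.adj_iff i x hx y hy).2 h')
    have hsA := h.cls_subset i hs
    have hsx : s ≠ x := fun e => hxs (e ▸ hs)
    have h1 : FactorizableOff G (Aᶜ ∪ {s, x}) := by
      by_contra h1
      exact hxs ((h.mem_cls_iff i s hs x hx hsx).2 h1)
    obtain ⟨m, hm, -, hm2⟩ := h.extend_foundation
      (by rintro v (rfl | rfl) <;> assumption) h1
    have hyx : y ≠ x := fun e => h.disjoint i y hy (e ▸ hx)
    have hyU : y ∉ ({s, x} : Set V) := by
      rintro (rfl | rfl)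
      · exact h.disjoint i _ hy hsA
      · exact hyx rfl
    refine ⟨hyx.symm, (h.shift hm hs (by simp) (hm2 i y hy) (hm.notMem hyU)
      (by rwa [hm.invol])).congr ?_⟩
    ext v
    simp only [hm.invol, Set.mem_sdiff, Set.mem_union, Set.mem_insert_iff, Set.mem_singleton_iff]
    grind
  rcases h.cover x with hx | ⟨i, hx⟩ <;> rcases h.cover y with hy | ⟨j, hy⟩
  · obtain ⟨m, hm, -⟩ := h.extend_foundation (U := {x, y})
      (by rintro v (rfl | rfl) <;> assumption) (h.saturated_foundation x hx y hy hne hadj)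
    exact ⟨hne, m, hm⟩
  · exact hAt j x hx y hy hadj
  · exact (hAt i y hy x hx (fun h' => hadj h'.symm)).symm
  · by_cases hij : i = j
    · subst hij
      obtain ⟨m, hm, -⟩ := h.exists_glue (U := {x, y})
        (h.factorizableOff_foundation_of_disjoint (by
          rintro v (rfl | rfl)
          · exact h.disjoint i _ hx
          · exact h.disjoint i _ hy))
        (fun k => by
          by_cases hk : k = i
          · rw [hk]; exact h.saturated_tower i x hx y hy hne hadj
          · refine h.factorizableOff_tower_of_disjoint ?_
            rintro v (rfl | rfl) hv
            · exact hk (h.eq_of_mem k i _ hv hx)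
            · exact hk (h.eq_of_mem k i _ hv hy))
      exact ⟨hne, m, hm⟩
    · -- Delete a vertex of each of the two classes, and match it to the partner of `x` or `y`.
      obtain ⟨s, hs⟩ := h.cls_nonempty i
      obtain ⟨t, ht⟩ := h.cls_nonempty j
      have hsA := h.cls_subset i hs
      have htA := h.cls_subset j ht
      have htj : t ∉ cls i := fun h' => hij (h.eq_of_mem_cls i j t h' ht)
      have hst : s ≠ t := fun e => htj (e ▸ hs)
      have h1 : FactorizableOff G (Aᶜ ∪ {s, t}) := by
        by_contra h1
        exact htj ((h.mem_cls_iff i s hs t htA hst).2 h1)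
      obtain ⟨m, hm, -, hm2⟩ := h.extend_foundation
        (by rintro v (rfl | rfl) <;> assumption) h1
      have hmx := hm2 i x hx
      have hmy := hm2 j y hy
      have hnA : ∀ {k z}, z ∈ tw k → z ≠ s ∧ z ≠ t := fun {k z} hz =>
        ⟨fun e => h.disjoint k z hz (e ▸ hsA), fun e => h.disjoint k z hz (e ▸ htA)⟩
      have n1 := hnA hx
      have n2 := hnA hy
      have n3 := hnA hmx
      have n4 := hnA hmy
      have n5 := (hm.adj x (by simp [n1])).ne
      have n6 := (hm.adj y (by simp [n2])).ne
      have n7 : m x ≠ y := fun e => hij (h.eq_of_mem i j _ hmx (e ▸ hy))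
      have n8 : m y ≠ x := fun e => hij (h.eq_of_mem i j _ hx (e ▸ hmy))
      have n9 : m x ≠ m y := fun e => hne (hm.inj e)
      have h2 : FactorizableOff G {s, t, x, m x, y, m y} := by
        refine (hm.union (A := {x, m x, y, m y}) ?_).congr ?_
        · rintro v (rfl | rfl | rfl | rfl) <;> simp [hm.invol]
        · ext v; simp only [Set.mem_union, Set.mem_insert_iff, Set.mem_singleton_iff]; tauto
      refine ⟨hne, ((h2.diff_pair (x := s) (y := m x) (by simp) (by simp)
        ((h.adj_iff i s hsA _ hmx).2 hs)).diff_pair (x := t) (y := m y) ?_ ?_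
        ((h.adj_iff j t htA _ hmy).2 ht)).congr ?_⟩
      · simp only [Set.mem_sdiff, Set.mem_insert_iff, Set.mem_singleton_iff]; grind
      · simp only [Set.mem_sdiff, Set.mem_insert_iff, Set.mem_singleton_iff]; grind
      · ext v; simp only [Set.mem_sdiff, Set.mem_insert_iff, Set.mem_singleton_iff]; grind

lemma saturated [Finite V] (h : IsDecomposition G A cls tw) : Saturated G := by
  rw [saturated_iff]
  obtain ⟨m, hm, -⟩ := h.exists_perfect
  exact ⟨hm.factorizableOff, fun x y hne hadj => h.linked_of_not_adj hne hadj⟩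

variable [Finite V]

/-- A matching which misses an even number of vertices of each tower can be replaced, inside the
foundation, by one that does not leave the foundation. -/
lemma factorizableOff_foundation (h : IsDecomposition G A cls tw) {U : Set V}
    (hU : ∀ i, Even (tw i ∩ U).ncard) (hF : FactorizableOff G U) :
    FactorizableOff G (Aᶜ ∪ U) := by
  classical
  obtain ⟨m, hm⟩ := hF
  obtain ⟨n, hn, -, hn2⟩ := h.exists_perfect
  have hc : ∀ v, ∃ o : Option ι, ∀ i, v ∈ cls i ↔ o = some i := fun v => by
    by_cases hv : ∃ i, v ∈ cls i
    · obtain ⟨i, hi⟩ := hv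
      exact ⟨some i, fun j => by
        simpa using ⟨fun hj => h.eq_of_mem_cls i j v hi hj, fun e => e ▸ hi⟩⟩
    · exact ⟨none, by simpa using hv⟩
  choose ℓ hℓ using hc
  have hcross : ∀ i, ∀ x ∈ tw i, x ∉ U → m x ∉ tw i → m x ∈ cls i := by
    intro i x hx hxU hmx
    have hadj := hm.adj x hxU
    rcases h.cover (m x) with h1 | ⟨j, h1⟩
    · exact (h.adj_iff i _ h1 x hx).1 hadj.symm
    · exact absurd hadj (h.not_adj i j x hx _ h1 (fun e => hmx (e ▸ h1)))
  refine hm.factorizableOff_of_towers ℓ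
    (tw := fun o => {x | ∃ i, o = some i ∧ x ∈ tw i}) ?_ ?_ ?_ ?_ ?_ ?_
  · intro x hx y hy hne e
    obtain ⟨i, hi⟩ := h.cls_cover x hx
    have hi' : y ∈ cls i := by rw [hℓ, ← e, ← hℓ]; exact hi
    by_contra hadj
    exact (h.mem_cls_iff i x hi y hy hne).1 hi' (h.saturated_foundation x hx y hy hne hadj)
  · intro o
    refine hn.even_ncard (by simp) ?_
    rintro x ⟨i, hi, hx⟩
    exact ⟨i, hi, hn2 i x hx⟩
  · intro o
    cases o with
    | none => simp
    | some i => simpa using hU i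
  · rintro o x ⟨i, -, hx⟩
    exact h.disjoint i x hx
  · intro s hs hms
    have hsU : s ∉ U := fun h => hms (by rwa [hm.fixed s h])
    obtain ⟨i, hi⟩ := (h.cover (m s)).resolve_left hms
    exact ⟨i, (hℓ s i).1 ((h.adj_iff i s hs _ hi).1 (hm.adj s hsU)), hi⟩
  · rintro o x ⟨i, rfl, hx⟩ hxU hmx
    have := hcross i x hx hxU (fun h' => hmx ⟨i, rfl, h'⟩)
    exact ⟨h.cls_subset i this, (hℓ _ i).1 this⟩

lemma linked_iff (h : IsDecomposition G A cls tw) {i : ι} {v w : V} (hv : v ∈ cls i) (hw : w ∈ A)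
    (hne : v ≠ w) : Linked G v w ↔ w ∉ cls i := by
  have hvA := h.cls_subset i hv
  have hsub : ({v, w} : Set V) ⊆ A := by rintro u (rfl | rfl) <;> assumption
  rw [h.mem_cls_iff i v hv w hw hne, not_not]
  constructor
  · refine fun hl => h.factorizableOff_foundation (fun j => ?_) hl.2
    rw [Set.disjoint_iff_inter_eq_empty.1, Set.ncard_empty]
    · exact Even.zero
    · exact Set.disjoint_left.2 fun x hx hxU => h.disjoint j x hx (hsub hxU)
  · intro hF
    obtain ⟨m, hm, -⟩ := h.extend_foundation hsub hF
    exact ⟨hne, m, hm⟩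

/-- No edge between the foundation and the towers is allowed. The matching edges between a class and
its tower are even in number; if there are any, delete the ends of two of them. -/
lemma map_mem (h : IsDecomposition G A cls tw) {m : V → V} (hm : IsMatchingMap G ∅ m) :
    ∀ v ∈ A, m v ∈ A := by
  intro s hs
  by_contra hms
  obtain ⟨i, hi⟩ := (h.cover (m s)).resolve_left hms
  obtain ⟨n, hn, -, hn2⟩ := h.exists_perfect
  have hev := hn.even_ncard (A := tw i) (by simp) (hn2 i)
  rw [hm.even_ncard_iff _ (by simp)] at hev
  have hmem : m s ∈ {v ∈ tw i | m v ∉ tw i} :=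
    ⟨hi, by rw [hm.invol]; exact fun h' => h.disjoint i s h' hs⟩
  obtain ⟨c, ⟨hc, hmc⟩, hcs⟩ : ∃ c ∈ {v ∈ tw i | m v ∉ tw i}, c ≠ m s := by
    by_contra! hcon
    have : {v ∈ tw i | m v ∉ tw i} = {m s} := Set.eq_singleton_iff_unique_mem.2 ⟨hmem, hcon⟩
    rw [this, Set.ncard_singleton] at hev
    exact absurd hev (by decide)
  have hcA : m c ∈ A := by
    rcases h.cover (m c) with h1 | ⟨j, h1⟩
    · exact h1
    · exact absurd (hm.adj c (by simp)) (h.not_adj i j c hc _ h1 (fun e => hmc (e ▸ h1)))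
  have hs' : s ∈ cls i := (h.adj_iff i s hs _ hi).1 (hm.adj s (by simp))
  have hc' : m c ∈ cls i := (h.adj_iff i _ hcA c hc).1 (hm.adj c (by simp)).symm
  have hne : s ≠ m c := fun e => hcs (by rw [e, hm.invol])
  have hU : FactorizableOff G {s, m s, m c, c} := by
    refine (hm.union (A := {s, m s, m c, c}) ?_).congr (by simp)
    rintro v (rfl | rfl | rfl | rfl) <;> simp [hm.invol]
  refine (h.mem_cls_iff i s hs' _ hcA hne).1 hc' ((h.factorizableOff_foundation (fun j => ?_)
    hU).congr ?_)
  · by_cases hj : j = i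
    · subst hj
      have : tw j ∩ {s, m s, m c, c} = {m s, c} := by
        ext v
        simp only [Set.mem_inter_iff, Set.mem_insert_iff, Set.mem_singleton_iff]
        constructor
        · rintro ⟨h1, rfl | rfl | rfl | rfl⟩
          · exact absurd hs (h.disjoint j _ h1)
          · simp
          · exact absurd h1 hmc
          · simp
        · rintro (rfl | rfl) <;> simp [hi, hc]
      rw [this, Set.ncard_pair hcs.symm]
      exact even_two
    · rw [Set.disjoint_iff_inter_eq_empty.1, Set.ncard_empty]
      · exact Even.zero
      · rw [Set.disjoint_left]
        rintro v hv (rfl | rfl | rfl | rfl)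
        · exact h.disjoint j _ hv hs
        · exact hj (h.eq_of_mem j i _ hv hi)
        · exact h.disjoint j _ hv hcA
        · exact hj (h.eq_of_mem j i _ hv hc)
  · have h1 := h.disjoint i _ hc
    ext v
    simp only [Set.mem_union, Set.mem_compl_iff, Set.mem_insert_iff, Set.mem_singleton_iff]
    grind

lemma map_mem_tower (h : IsDecomposition G A cls tw) {m : V → V} (hm : IsMatchingMap G ∅ m)
    {i : ι} : ∀ x ∈ tw i, m x ∈ tw i := by
  intro x hx
  rcases h.cover (m x) with h1 | ⟨j, h1⟩
  · exact absurd (by simpa [hm.invol] using h.map_mem hm _ h1) (h.disjoint i x hx)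
  · by_cases hij : i = j
    · exact hij ▸ h1
    · exact absurd (hm.adj x (by simp)) (h.not_adj i j x hx _ h1 hij)

/-- The foundation consists of the vertices which lie above no vertex. -/
lemma mem_iff_not_above (h : IsDecomposition G A cls tw) (v : V) :
    v ∈ A ↔ ∀ y, ¬ Above G y v := by
  have hG := h.saturated
  obtain ⟨n, hn, hn1, hn2⟩ := h.exists_perfect
  constructor
  · rintro hv y ⟨hne, hl, hz⟩
    have hvy : G.Adj v y := hG.adj_of_not_linked hne (fun h' => hl h'.symm)
    rcases h.cover y with hy | ⟨i, hy⟩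
    · obtain ⟨i, hi⟩ := h.cls_cover y hy
      have hvi : v ∈ cls i := by
        by_contra hvi
        exact hl ((h.linked_iff hi hv hne.symm).2 hvi)
      have hnv := hn.linked v
      have h1 := (h.linked_iff hvi (hn1 v hv) hnv.1).1 hnv
      exact hz (n v) ((h.linked_iff hi (hn1 v hv) (fun e => h1 (e ▸ hi))).2 h1)
        (hn.adj v (by simp)).symm
    · have hvi := (h.adj_iff i v hv y hy).1 hvy
      exact hz (n y) (hn.linked y) ((h.adj_iff i v hv _ (hn2 i y hy)).2 hvi).symm
  · intro hab
    by_contra hv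
    obtain ⟨i, hi⟩ := (h.cover v).resolve_left hv
    obtain ⟨y, hy⟩ := h.cls_nonempty i
    have hyA := h.cls_subset i hy
    -- An edge between the class and the tower is not allowed.
    have hnot : ∀ x ∈ tw i, ¬ Linked G y x := fun x hx hl => by
      obtain ⟨m, hm, rfl⟩ := hl.exists_isMatchingMap ((h.adj_iff i y hyA x hx).2 hy)
      exact h.disjoint i _ hx (h.map_mem hm y hyA)
    refine hab y ⟨fun e => hv (e ▸ hyA), hnot v hi, fun z hl hadj => ?_⟩
    rcases h.cover z with hz | ⟨j, hz⟩
    · exact (h.linked_iff hy hz hl.1).1 hl ((h.adj_iff i z hz v hi).1 hadj)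
    · by_cases hij : j = i
      · exact hnot z (hij ▸ hz) hl
      · exact h.not_adj j i z hz v hi hij hadj

end IsDecomposition

/-! ### The cathedral construction -/

section Cathedral

variable {V : Type*} {G : SimpleGraph V}

lemma coe_eq_induce {H : G.Subgraph} (h : ∀ u ∈ H.verts, ∀ v ∈ H.verts, G.Adj u v → H.Adj u v) :
    H.coe = G.induce H.verts := by
  ext u v
  exact ⟨fun h' => h'.adj_sub, fun h' => h u u.2 v v.2 h'⟩

lemma IsCathedral.coe_foundation {G₀ : G.Subgraph} {T : canonicalPartition G₀.coe → G.Subgraph}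
    (h : IsCathedral G G₀ T) : G₀.coe = G.induce G₀.verts := by
  obtain ⟨φ, h1, h2⟩ := h.construction
  refine coe_eq_induce fun u hu v hv huv => ?_
  have := φ.map_adj_iff (v := Sum.inl ⟨u, hu⟩) (w := Sum.inl ⟨v, hv⟩)
  rw [h1, h1] at this
  exact this.1 huv

lemma IsCathedral.coe_tower {G₀ : G.Subgraph} {T : canonicalPartition G₀.coe → G.Subgraph}
    (h : IsCathedral G G₀ T) (S : canonicalPartition G₀.coe) :
    (T S).coe = G.induce (T S).verts := by
  obtain ⟨φ, h1, h2⟩ := h.construction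
  refine coe_eq_induce fun u hu v hv huv => ?_
  have := φ.map_adj_iff (v := Sum.inr ⟨S, ⟨u, hu⟩⟩) (w := Sum.inr ⟨S, ⟨v, hv⟩⟩)
  rw [h2, h2] at this
  obtain ⟨S', a, b, ha, hb, hab⟩ := this.1 huv
  cases ha
  cases hb
  exact hab

/-- For an induced subgraph on a set closed under all perfect matchings, being allowed in the
subgraph is being allowed in the whole graph. -/
lemma isAllowed_coe_iff (h₀ : FactorizableOff G ∅) {H : G.Subgraph}
    (hH : H.coe = G.induce H.verts)
    (hcl : ∀ m, IsMatchingMap G ∅ m → ∀ v ∈ H.verts, m v ∈ H.verts) (e : Sym2 H.verts) :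
    IsAllowed H.coe e ↔ IsAllowed G (e.map Subtype.val) := by
  induction e with
  | _ a b =>
    rw [Sym2.map_mk, isAllowed_iff, isAllowed_iff, hH, linked_induce_iff]
    refine and_congr_right fun hadj => ⟨fun h => ?_, fun h => ?_⟩
    · obtain ⟨n, hn⟩ := h₀
      refine ⟨h.1, hn.factorizableOff_of_closed (hcl n hn) ?_ h.2⟩
      rintro v (rfl | rfl)
      · exact a.2
      · exact b.2
    · obtain ⟨m, hm, hab⟩ := h.exists_isMatchingMap hadj
      refine ⟨h.1, (hm.union (A := H.vertsᶜ ∪ {(a : V), (b : V)}) ?_).congr (by simp)⟩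
      rintro v (hv | rfl | rfl)
      · exact Or.inl fun h' => hv (by simpa [hm.invol] using hcl m hm _ h')
      · simp [hab]
      · simp [← hab, hm.invol]

variable [Finite V]

/-- In an elementary graph each class of the canonical partition is the class of each of its
members. -/
lemma Elementary.eq_class (hG : Elementary G) {S : Set V} (hS : S ∈ canonicalPartition G) {v : V}
    (hv : v ∈ S) : S = {w | ¬ Linked G v w} := by
  obtain ⟨u, rfl⟩ := hS
  simp only [Set.mem_ofPred_eq, canonicalRel_iff hG.2] at hv ⊢
  by_cases huv : u = v
  · rw [huv]
  ext w
  exact ⟨fun h => hG.not_linked_trans (fun h' => hv h'.symm) h (Ne.symm huv),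
    fun h => hG.not_linked_trans hv h huv⟩

lemma Saturated.induce_factorizableOff {A : Set V} (h : Saturated (G.induce A)) :
    FactorizableOff G Aᶜ := by
  simpa using factorizableOff_induce_iff.1 h.factorizableOff

lemma Saturated.induce_factorizableOff_pair {A : Set V} (h : Saturated (G.induce A)) {x y : V}
    (hx : x ∈ A) (hy : y ∈ A) (hne : x ≠ y) (hadj : ¬ G.Adj x y) :
    FactorizableOff G (Aᶜ ∪ {x, y}) :=
  (linked_induce_iff.1 ((saturated_iff.1 h).2 ⟨x, hx⟩ ⟨y, hy⟩ (by simpa using hne) hadj)).2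

lemma IsCathedral.isDecomposition {G₀ : G.Subgraph} {T : canonicalPartition G₀.coe → G.Subgraph}
    (h : IsCathedral G G₀ T) :
    IsDecomposition G G₀.verts (fun S : canonicalPartition G₀.coe => Subtype.val '' S.1)
      (fun S => (T S).verts) := by
  have e₀ := h.coe_foundation
  have hs₀ := h.foundation_saturated
  have hel := h.foundation_elementary
  have hsT : ∀ S, Saturated (G.induce (T S).verts) := fun S => h.coe_tower S ▸ h.tower_saturated S
  have hlink : ∀ x y : G₀.verts, Linked G₀.coe x y ↔
      (x : V) ≠ y ∧ FactorizableOff G (G₀.vertsᶜ ∪ {(x : V), (y : V)}) := fun x y => by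
    rw [e₀]; exact linked_induce_iff
  have hs₀' : Saturated (G.induce G₀.verts) := e₀ ▸ hs₀
  obtain ⟨φ, h1, h2⟩ := h.construction
  have hinl : ∀ {v} (hv : v ∈ G₀.verts), φ (Sum.inl ⟨v, hv⟩) = v := fun hv => h1 ⟨_, hv⟩
  have hinr : ∀ {S v} (hv : v ∈ (T S).verts), φ (Sum.inr ⟨S, ⟨v, hv⟩⟩) = v :=
    fun {S} _ hv => h2 S ⟨_, hv⟩
  exact
    { cover := fun v => by
        obtain ⟨(x | ⟨S, y⟩), rfl⟩ := φ.surjective v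
        · exact Or.inl (h1 x ▸ x.2)
        · exact Or.inr ⟨S, h2 S y ▸ y.2⟩
      disjoint := fun S v hv hv' => by
        have := φ.injective ((hinr hv).trans (hinl hv').symm)
        cases this
      eq_of_mem := fun S S' v hv hv' => by
        have := φ.injective ((hinr hv).trans (hinr hv').symm)
        rw [Sum.inr.injEq] at this
        exact congrArg Sigma.fst this
      cls_subset := by
        rintro S _ ⟨x, -, rfl⟩
        exact x.2
      cls_cover := fun v hv => by
        refine ⟨⟨{w | CanonicalRel G₀.coe ⟨v, hv⟩ w}, ⟨v, hv⟩, rfl⟩, ⟨v, hv⟩, ?_, rfl⟩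
        exact (canonicalRel_iff hel.2).2 fun h => h.1 rfl
      cls_nonempty := by
        rintro ⟨_, u, rfl⟩
        exact ⟨u, u, (canonicalRel_iff hel.2).2 fun h => h.1 rfl, rfl⟩
      eq_of_mem_cls := by
        rintro S S' _ ⟨x, hx, rfl⟩ ⟨x', hx', e⟩
        rw [Subtype.val_injective e] at hx'
        exact Subtype.ext ((hel.eq_class S.2 hx).trans (hel.eq_class S'.2 hx').symm)
      mem_cls_iff := by
        rintro S _ ⟨v, hv, rfl⟩ w hw hne
        have h3 : w ∈ Subtype.val '' S.1 ↔ (⟨w, hw⟩ : G₀.verts) ∈ S.1 := by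
          simp [hw]
        rw [h3, hel.eq_class S.2 hv, Set.mem_ofPred_eq, hlink]
        tauto
      adj_iff := fun S v hv x hx => by
        have := φ.map_adj_iff (v := Sum.inl ⟨v, hv⟩) (w := Sum.inr ⟨S, ⟨x, hx⟩⟩)
        rw [hinl, hinr] at this
        rw [this]
        change (⟨v, hv⟩ : G₀.verts) ∈ S.1 ↔ _
        simp [hv]
      not_adj := fun S S' x hx y hy hne hxy => by
        have := φ.map_adj_iff (v := Sum.inr ⟨S, ⟨x, hx⟩⟩) (w := Sum.inr ⟨S', ⟨y, hy⟩⟩)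
        rw [hinr, hinr] at this
        obtain ⟨R, a, b, ha, hb, -⟩ := this.1 hxy
        exact hne ((congrArg Sigma.fst ha).trans (congrArg Sigma.fst hb).symm)
      factorizable_foundation := hs₀'.induce_factorizableOff
      saturated_foundation := fun x hx y hy => hs₀'.induce_factorizableOff_pair hx hy
      factorizable_tower := fun S => (hsT S).induce_factorizableOff
      saturated_tower := fun S x hx y hy => (hsT S).induce_factorizableOff_pair hx hy }

/-- The bottom vertices and the sets of vertices above them make a saturated graph a cathedral. -/
theorem Saturated.exists_isCathedral [Nonempty V] (hG : Saturated G) :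
    ∃ (G₀ : G.Subgraph) (T : canonicalPartition G₀.coe → G.Subgraph), IsCathedral G G₀ T := by
  let G₀ : G.Subgraph := (⊤ : G.Subgraph).induce {x | IsBottom G x}
  have e₀ : G₀.coe = bottomGraph G := coe_eq_induce fun u hu v hv huv => ⟨hu, hv, huv⟩
  have hs₀ : Saturated G₀.coe := by rw [e₀]; exact saturated_bottomGraph hG
  have hc₀ : (allowedGraph G₀.coe).Connected := by
    rw [e₀]; exact connected_allowedGraph_bottomGraph hG
  have hlink : ∀ x y : G₀.verts, Linked G₀.coe x y ↔ Linked G (x : V) y := fun x y => by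
    rw [e₀]; exact linked_bottomGraph_iff hG
  let T : canonicalPartition G₀.coe → G.Subgraph := fun S =>
    (⊤ : G.Subgraph).induce {x | ∃ v ∈ S.1, Above G (v : V) x}
  -- Every class has a representative, and the tower consists of the vertices above it.
  have hrep : ∀ S : canonicalPartition G₀.coe, ∃ u : G₀.verts,
      (∀ v, v ∈ S.1 ↔ ¬ Linked G (u : V) v) ∧ ∀ x, x ∈ (T S).verts ↔ Above G (u : V) x := by
    rintro ⟨_, u, rfl⟩
    have hmem : ∀ v, CanonicalRel G₀.coe u v ↔ ¬ Linked G (u : V) v := fun v => by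
      rw [canonicalRel_iff hc₀, hlink]
    refine ⟨u, hmem, fun x => ⟨?_, fun hx => ⟨u, (hmem u).2 fun h => h.1 rfl, hx⟩⟩⟩
    rintro ⟨v, hv, hx⟩
    exact IsBottom.above_of_above v.2 u.2 (fun h => (hmem v).1 hv h.symm) hx
  let f : G₀.verts ⊕ (Σ S, (T S).verts) → V := Sum.elim Subtype.val fun p => p.2.1
  have hf : Function.Bijective f := by
    constructor
    · rintro (x | ⟨S, x⟩) (y | ⟨S', y⟩) (e : (x : V) = y)
      · rw [Subtype.ext e]
      · obtain ⟨u, -, hu⟩ := hrep S'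
        exact absurd ((hu y).1 y.2) (e ▸ x.2 u)
      · obtain ⟨u, -, hu⟩ := hrep S
        exact absurd ((hu x).1 x.2) (e ▸ y.2 u)
      · obtain ⟨u, hu, hu'⟩ := hrep S
        obtain ⟨w, hw, hw'⟩ := hrep S'
        have hl := IsBottom.not_linked_of_above hG ((hu' x).1 x.2) (e ▸ (hw' y).1 y.2)
        have : S = S' := by
          refine Subtype.ext (Set.ext fun v => ?_)
          rw [hu, hw, IsBottom.linked_iff u.2 w.2 hl]
        subst this
        rw [Subtype.ext e]
    · intro x
      rcases isBottom_or_above hG x with hx | ⟨v, hv, hx⟩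
      · exact ⟨Sum.inl ⟨x, hx⟩, rfl⟩
      · refine ⟨Sum.inr ⟨⟨{w | CanonicalRel G₀.coe ⟨v, hv⟩ w}, ⟨v, hv⟩, rfl⟩,
          ⟨x, ⟨⟨v, hv⟩, ?_, hx⟩⟩⟩, rfl⟩
        exact (canonicalRel_iff hc₀).2 fun h => h.1 rfl
  have hcross : ∀ (x : G₀.verts) (S : canonicalPartition G₀.coe) (y : (T S).verts),
      G.Adj (x : V) y ↔ x ∈ S.1 := fun x S y => by
    obtain ⟨u, hu, hu'⟩ := hrep S
    rw [hu]
    exact IsBottom.adj_iff hG x.2 u.2 ((hu' y).1 y.2)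
  refine ⟨G₀, T, hs₀, ⟨hs₀.1, hc₀⟩, fun S => ?_, ⟨Equiv.ofBijective f hf, fun {a b} => ?_⟩,
    fun x => rfl, fun S y => rfl⟩
  · obtain ⟨u, -, hu⟩ := hrep S
    have e₁ : (T S).coe = G.induce (T S).verts :=
      coe_eq_induce fun u hu v hv huv => ⟨hu, hv, huv⟩
    have e₂ : (T S).verts = {x | Above G (u : V) x} := Set.ext hu
    rw [e₁, e₂]
    exact saturated_tower hG u.2
  · change G.Adj (f a) (f b) ↔ (cathedral G₀.coe fun S => (T S).coe).Adj a b
    rcases a with x | ⟨S, x⟩ <;> rcases b with y | ⟨S', y⟩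
    · exact ⟨fun h => ⟨x.2, y.2, h⟩, fun h => (show G₀.Adj x y from h).adj_sub⟩
    · exact hcross x S' y
    · exact G.adj_comm _ _ |>.trans (hcross y S x)
    · constructor
      · intro hadj
        change G.Adj (x : V) y at hadj
        obtain ⟨u, hu, hu'⟩ := hrep S
        obtain ⟨w, hw, hw'⟩ := hrep S'
        have hl : ¬ Linked G (u : V) w := fun hl =>
          IsBottom.not_adj_of_above w.2 hl ((hu' x).1 x.2) ((hw' y).1 y.2) hadj
        have : S = S' := by
          refine Subtype.ext (Set.ext fun v => ?_)
          rw [hu, hw, IsBottom.linked_iff u.2 w.2 hl]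
        subst this
        exact ⟨S, x, y, rfl, rfl, x.2, y.2, hadj⟩
      · rintro ⟨R, a, b, ha, hb, hab⟩
        cases ha
        cases hb
        exact (show (T S).Adj x b from hab).adj_sub

end Cathedral

theorem mainTheorem1 {V : Type*} [Finite V] [Nonempty V] (G : SimpleGraph V) :
    (Saturated G ↔
      ∃ (G₀ : G.Subgraph) (T : canonicalPartition G₀.coe → G.Subgraph), IsCathedral G G₀ T) ∧
    ∀ (G₀ : G.Subgraph) (T : canonicalPartition G₀.coe → G.Subgraph), IsCathedral G G₀ T →
      (∀ e ∈ G.edgeSet, IsAllowed G e ↔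
        (∃ f : Sym2 G₀.verts, IsAllowed G₀.coe f ∧ f.map Subtype.val = e) ∨
        ∃ (S : canonicalPartition G₀.coe) (f : Sym2 (T S).verts),
          IsAllowed (T S).coe f ∧ f.map Subtype.val = e) ∧
      (∀ (G₀' : G.Subgraph) (T' : canonicalPartition G₀'.coe → G.Subgraph),
        IsCathedral G G₀' T' → G₀.verts = G₀'.verts) ∧
      G₀.verts = Set.univ \ ⋃ x : V, gallaiCDelete G x := by
  have hC : ∀ (G₀ : G.Subgraph) (T : canonicalPartition G₀.coe → G.Subgraph),
      IsCathedral G G₀ T → G₀.verts = Set.univ \ ⋃ x : V, gallaiCDelete G x := by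
    intro G₀ T h
    ext v
    rw [h.isDecomposition.mem_iff_not_above]
    simp [gallaiCDelete_eq h.isDecomposition.saturated.factorizableOff]
  refine ⟨⟨Saturated.exists_isCathedral, fun ⟨G₀, T, h⟩ => h.isDecomposition.saturated⟩,
    fun G₀ T h => ⟨fun e he => ?_, fun G₀' T' h' => (hC G₀ T h).trans (hC G₀' T' h').symm,
      hC G₀ T h⟩⟩
  have hd := h.isDecomposition
  have h₀ := hd.saturated.factorizableOff
  have hA := isAllowed_coe_iff h₀ h.coe_foundation (fun m hm => hd.map_mem hm)
  have hT := fun S => isAllowed_coe_iff h₀ (h.coe_tower S) (fun m hm => hd.map_mem_tower hm)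
  constructor
  · intro hal
    induction e with
    | _ x y =>
      obtain ⟨hadj, hl⟩ := isAllowed_iff.1 hal
      obtain ⟨m, hm, rfl⟩ := hl.exists_isMatchingMap hadj
      rcases hd.cover x with hx | ⟨S, hx⟩
      · exact Or.inl ⟨s(⟨x, hx⟩, ⟨m x, hd.map_mem hm x hx⟩), (hA _).2 hal, rfl⟩
      · exact Or.inr ⟨S, s(⟨x, hx⟩, ⟨m x, hd.map_mem_tower hm x hx⟩), (hT S _).2 hal, rfl⟩
  · rintro (⟨f, hf, rfl⟩ | ⟨S, f, hf, rfl⟩)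
    · exact (hA f).1 hf
    · exact (hT S f).1 hf
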